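/- **Theorem 1.2.** Let $B_n$ be the hyperoctahedral group, i.e. the set of words $w=x_1x_2\cdots x_n$ with letters in $\{-n,\dots,-1,1,\dots,n\}$ such that $|x_1||x_2|\cdots|x_n|$ is a permutation of $12\cdots n$. A word $x_1\cdots x_m$ of distinct integers is a *desarrangement* if it is empty, or if $x_1>x_2>\cdots>x_{2k}$ and $x_{2k}<x_{2k+1}$ for some $k\ge 1$, where $x_{m+1}:=\infty$. Each $w\in B_n$ has a unique *pixed factorization* $w=w^-w^+w^d$, where $w^d$ is the longest right factor of $w$ that is a desarrangement, and $w^-$ and $w^+$ are increasing words with only negative, respectively only positive, letters. Let $\mathrm{pix}^-w$ and $\mathrm{pix}^+w$ be the numbers of letters of $w^-$ and $w^+$, let $\mathrm{neg}\,w$ be the number of negative letters of $w$, and let $$\ell(w)=\#\{i<j:x_i>x_j\}+\sum_{x_i<0}|x_i|$$ be the length function of $B_n$. Write $(a;q)_n=\prod_{i=0}^{n-1}(1-aq^i)$, $(a;q)_\infty=\prod_{i\ge0}(1-aq^i)$ and ${n\brack m_1,\dots,m_r}_q=\frac{(q;q)_n}{(q;q)_{m_1}\cdots(q;q)_{m_r}}$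 for $m_1+\cdots+m_r=n$. Let $D_n(q)=\sum_\sigma q^{\mathrm{maj}\,\sigma}$, where $\sigma$ runs over the derangements of $\{1,\dots,n\}$ and $\mathrm{maj}\,\sigma$ is the sum of all $i$ with $1\le i\le n-1$ and $\sigma(i)>\sigma(i+1)$. Let $q,Y_0,Y_1,Z,u$ be indeterminates. Define the sequence ${}^{\ell}B_n={}^{\ell}B_n(q,Y_0,Y_1,Z)$ $(n\ge0)$ by the identity $$\sum_{n\ge0}\frac{u^n}{(-Zq;q)_n(q;q)_n}\,{}^{\ell}B_n=\Bigl(1-\frac{u}{1-q}\Bigr)^{-1}(u;q)_\infty\sum_{n\ge0}\frac{(-qY_0^{-1}Y_1Z;q)_n(uY_0)^n}{(-Zq;q)_n(q;q)_n}\qquad(1.7)$$ of formal power series in $u$, whose coefficients are power series in $q$ over $\mathbb Q(Y_0,Y_1,Z)$. Then, for every $n\ge0$, $${}^{\ell}B_n(q,Y_0,Y_1,Z)=\sum_{w\in B_n}q^{\ell(w)}Y_0^{\mathrm{pix}^+w}Y_1^{\mathrm{pix}^-w}Z^{\mathrm{neg}\,w}.$$ Moreover, (1.7) is equivalent to the family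 of identities $${}^{\ell}B_n(q,Y_0,Y_1,Z)=\sum_{i+j+k+l=n}{n\brack i,j,k,l}_q\,q^{\binom{j+k+1}{2}}\,Y_0^i(Y_1Z)^j(Zq^i)^kD_{k+l}(q)\qquad(n\ge0).$$ -/

import Mathlib

open scoped PowerSeries PowerSeries.WithPiTopology

namespace SignedPixed

noncomputable section

/-! ### Signed permutations and their statistics -/

/-- The hyperoctahedral group `B_n`, as the finite set of words `x_1 x_2 ⋯ x_n` (the letter `x_(i+1)`
is `x i`) with letters in `{-n, …, -1, 1, …, n}` such that `|x_1| |x_2| ⋯ |x_n|` is a permutation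
of `1 2 ⋯ n`. -/
def signedPerms (n : ℕ) : Finset (Fin n → ℤ) :=
  (Fintype.piFinset fun _ : Fin n => (Finset.Icc (-(n : ℤ)) n).erase 0).filter
    fun x => Function.Injective fun i => |x i|

/-- The number of inversions of a word. -/
def inv {n : ℕ} (x : Fin n → ℤ) : ℕ :=
  (Finset.univ.filter fun p : Fin n × Fin n => p.1 < p.2 ∧ x p.1 > x p.2).card

/-- The length function of `B_n`: `ℓ(w) = inv w + ∑ |x_i|`, the sum being over the negative
letters. -/
def len {n : ℕ} (x : Fin n → ℤ) : ℕ :=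
  inv x + ∑ i, if x i < 0 then (x i).natAbs else 0

/-- The number of negative letters. -/
def neg {n : ℕ} (x : Fin n → ℤ) : ℕ :=
  (Finset.univ.filter fun i => x i < 0).card

/-- A word `x_1 x_2 ⋯ x_m` is a desarrangement if it is empty, or if
`x_1 > x_2 > ⋯ > x_{2k}` and `x_{2k} < x_{2k+1}` for some `k ≥ 1`, with the convention
`x_{m+1} = ∞`. (The letter `x_{i+1}` is `w.getD i 0`.) -/
def IsDesarrangement (w : List ℤ) : Prop :=
  w = [] ∨ ∃ k : ℕ, 1 ≤ k ∧ 2 * k ≤ w.length ∧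
    (∀ i : ℕ, i + 1 < 2 * k → w.getD i 0 > w.getD (i + 1) 0) ∧
    (2 * k < w.length → w.getD (2 * k - 1) 0 < w.getD (2 * k) 0)

open Classical in
/-- The left factor `w⁻ w⁺` of the pixed factorization `w = w⁻ w⁺ wᵈ`: what is left of the word
when its longest right factor `wᵈ` that is a desarrangement has been removed. -/
def pixPrefix : List ℤ → List ℤ
  | [] => []
  | a :: w => if IsDesarrangement (a :: w) then [] else a :: pixPrefix w

/-- `pix⁺ w`, the number of letters of the factor `w⁺` in the pixed factorization
`w = w⁻ w⁺ wᵈ`, that is, the number of positive letters of `w⁻ w⁺`. -/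
def pixPos {n : ℕ} (x : Fin n → ℤ) : ℕ :=
  (pixPrefix (List.ofFn x)).countP fun a => 0 < a

/-- `pix⁻ w`, the number of letters of the factor `w⁻` in the pixed factorization
`w = w⁻ w⁺ wᵈ`, that is, the number of negative letters of `w⁻ w⁺`. -/
def pixNeg {n : ℕ} (x : Fin n → ℤ) : ℕ :=
  (pixPrefix (List.ofFn x)).countP fun a => a < 0

/-- The major index `maj σ = ∑_{i=1}^{n-1} i χ(σ(i) > σ(i+1))` of a permutation of `n` letters. -/
def maj {n : ℕ} (σ : Equiv.Perm (Fin n)) : ℕ :=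
  ∑ i : Fin n, if h : (i : ℕ) + 1 < n then
    (if σ i > σ ⟨(i : ℕ) + 1, h⟩ then (i : ℕ) + 1 else 0) else 0

/-- The generating polynomial `D_n(q)` of the derangements of `n` letters by the major index. -/
def derangementPoly {A : Type*} [CommRing A] (n : ℕ) (q : A) : A :=
  ∑ σ : derangements (Fin n), q ^ maj σ.1

/-! ### `q`-series -/

/-- The `q`-ascending factorial `(a; q)_n`. -/
def qPoch {A : Type*} [CommRing A] (a q : A) (n : ℕ) : A :=
  ∏ i ∈ Finset.range n, (1 - a * q ^ i)

/-- The infinite product `(a; q)_∞`, in a commutative topological ring. -/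
def qPochInf {A : Type*} [CommRing A] [TopologicalSpace A] (a q : A) : A :=
  ∏' i : ℕ, (1 - a * q ^ i)

/-- The field `ℚ(Y₀, Y₁, Z)` of rational functions in three indeterminates. -/
abbrev K : Type := FractionRing (MvPolynomial (Fin 3) ℚ)

/-- The ring `ℚ(Y₀, Y₁, Z)⟦q⟧`. It contains `ℤ[q, Y₀, Y₁, Z]`, and in it `Y₀` and all
`(q; q)_n`, `(-Zq; q)_n` are invertible. -/
abbrev R : Type := K⟦X⟧

/-- The indeterminate `q`. -/
def q : R := PowerSeries.X

/-- The indeterminate `Y₀`. -/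
def Y₀ : R := PowerSeries.C (algebraMap (MvPolynomial (Fin 3) ℚ) K (MvPolynomial.X 0))

/-- The indeterminate `Y₁`. -/
def Y₁ : R := PowerSeries.C (algebraMap (MvPolynomial (Fin 3) ℚ) K (MvPolynomial.X 1))

/-- The indeterminate `Z`. -/
def Z : R := PowerSeries.C (algebraMap (MvPolynomial (Fin 3) ℚ) K (MvPolynomial.X 2))

/-- The indeterminate `u` of the ring `ℚ(Y₀, Y₁, Z)⟦q⟧⟦u⟧`. -/
def u : R⟦X⟧ := PowerSeries.X

/-- `ℚ(Y₀, Y₁, Z)` carries the discrete topology, so that the topology of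
`ℚ(Y₀, Y₁, Z)⟦q⟧⟦u⟧` is that of the stabilization of each coefficient of `q^i u^j`. -/
local instance : TopologicalSpace K := ⊥

/-- The infinite product `(u; q)_∞` in `ℚ(Y₀, Y₁, Z)⟦q⟧⟦u⟧`. -/
def uPochInf : R⟦X⟧ := qPochInf u (PowerSeries.C q)

/-- The product that defines `(u; q)_∞` converges. -/
theorem multipliable_uPochInf :
    Multipliable fun i : ℕ => 1 - u * (PowerSeries.C q : R⟦X⟧) ^ i := by
  have : DiscreteTopology K := ⟨rfl⟩
  have h : Multipliable fun i : ℕ => 1 + -(u * (PowerSeries.C q : R⟦X⟧) ^ i) := by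
    refine multipliable_one_add_of_summable_prod ?_
    rw [PowerSeries.WithPiTopology.summable_iff_summable_coeff]
    intro m
    rw [PowerSeries.WithPiTopology.summable_iff_summable_coeff]
    intro k
    refine summable_of_hasFiniteSupport ?_
    refine ((Finset.range (k + 1)).powerset.finite_toSet).subset ?_
    intro s hs
    simp only [Function.mem_support] at hs
    rw [Finset.mem_coe, Finset.mem_powerset]
    intro i hi
    rw [Finset.mem_range]
    by_contra hk
    apply hs
    have hsum : k < ∑ i ∈ s, i :=
      lt_of_lt_of_le (by omega) (Finset.single_le_sum (f := fun i : ℕ => i) (by simp) hi)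
    have hprod : ∏ i ∈ s, -(u * (PowerSeries.C q : R⟦X⟧) ^ i)
        = PowerSeries.C ((PowerSeries.X : R) ^ (∑ i ∈ s, i)) * (-u) ^ s.card := by
      simp_rw [← neg_mul]
      rw [Finset.prod_mul_distrib, Finset.prod_const, Finset.prod_pow_eq_pow_sum, map_pow, mul_comm]
      rfl
    rw [hprod, PowerSeries.coeff_C_mul, PowerSeries.coeff_X_pow_mul', if_neg (by omega)]
  simpa only [← sub_eq_add_neg] using h

/-- The `q`-multinomial coefficient with lower entries `m_1, …, m_r` and upper entry
`n = m_1 + ⋯ + m_r`, namely `(q; q)_n / ((q; q)_{m_1} ⋯ (q; q)_{m_r})`. -/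
def qMultinomial {r : ℕ} (m : Fin r → ℕ) : R :=
  qPoch q q (∑ s, m s) * (∏ s, qPoch q q (m s))⁻¹

/-- The identity in `ℚ(Y₀, Y₁, Z)⟦q⟧⟦u⟧`
`∑_n u^n B_n / ((-Zq; q)_n (q; q)_n)
  = (1 - u / (1 - q))⁻¹ (u; q)_∞ ∑_n (-q Y₀⁻¹ Y₁ Z; q)_n (u Y₀)^n / ((-Zq; q)_n (q; q)_n)`,
which defines the sequence `B = (B_n)_n` of the `q`-analogs. The three power series on the right
are in that ring because `1 - q`, `Y₀`, `(-Zq; q)_n`, `(q; q)_n` are units of `R` and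
`1 - u / (1 - q)` is a unit of `R⟦u⟧`. -/
def DefiningIdentity (B : ℕ → R) : Prop :=
  PowerSeries.mk (fun n => B n * (qPoch (-Z * q) q n * qPoch q q n)⁻¹) =
    Ring.inverse (1 - u * PowerSeries.C ((1 - q)⁻¹)) * uPochInf *
      PowerSeries.mk (fun n => qPoch (-q * Y₀⁻¹ * Y₁ * Z) q n * Y₀ ^ n *
        (qPoch (-Z * q) q n * qPoch q q n)⁻¹)

end

end SignedPixed

namespace SignedPixed

noncomputable section

/-! Everything goes through the q-multinomial formula. On the combinatorial side, a signed
permutation amounts to a choice of signs, a subset `V` of the resulting letters (those of `w⁻w⁺`,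
necessarily written in increasing order), and a desarrangement `d` of the remaining letters. Its
length splits into the inversions of `d`, the inversions between `V` and the rest, and the sum of
the absolute values of the negative letters. Desarrangements counted by inversions give `D_m(q)`
(`sum_desarrangements_pow_linv`), so only a sum over signs and subsets is left; adding the letters
by increasing absolute value evaluates it (`sum_splitSum`).

On the analytic side, two uses of the q-binomial theorem collapse the sums over `(i, j)` and over
`(k, l)` (`sum_qMultinomial_eq`). What remains is a coefficient of the product of the right-hand
series of the defining identity with `∑ D_n(q) u^n / (q; q)_n`.

Both sides rest on `∑ D_n(q) u^n / (q; q)_n = (1 - u/(1-q))⁻¹ (u; q)_∞`. Its proof counts words over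
`ℕ` by the sum of their letters. Stable sorting into weakly decreasing order attaches a permutation
`σ` to each word, and the words attached to `σ` have series `q^(maj σ) / (q; q)_n` (`card_sort_eq`).
A word has no fixed letter exactly when `σ` is a derangement. All words together give `(1 -
u/(1-q))⁻¹`, and forbidding `c` as a fixed letter multiplies the series by `1 - u q^c`
(`mk_freeSeries_insert`), whence the infinite product. Multiplying by `1/(u; q)_∞` gives a
recurrence for `D_n(q)`, which the pixed factorization of ordinary words shows to be the recurrence
for desarrangements by inversions. -/

open Finset

attribute [local instance] instTopologicalSpaceK

/-! ### q-factorials and the q-binomial theorem -/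

/-- The inverse of `(q; q)_n`. -/
def qFactInv (n : ℕ) : R := (qPoch q q n)⁻¹

theorem constantCoeff_q : PowerSeries.constantCoeff q = 0 := PowerSeries.constantCoeff_X

theorem qPoch_zero {A : Type*} [CommRing A] (a q : A) : qPoch a q 0 = 1 := rfl

theorem qPoch_succ {A : Type*} [CommRing A] (a q : A) (n : ℕ) :
    qPoch a q (n + 1) = qPoch a q n * (1 - a * q ^ n) := Finset.prod_range_succ _ _

theorem qPoch_add {A : Type*} [CommRing A] (a q : A) (m n : ℕ) :
    qPoch a q (m + n) = qPoch a q m * qPoch (a * q ^ m) q n := by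
  simp only [qPoch, Finset.prod_range_add, pow_add, mul_assoc]

theorem constantCoeff_qPoch {a : R} (ha : PowerSeries.constantCoeff a = 0) (n : ℕ) :
    PowerSeries.constantCoeff (qPoch a q n) = 1 := by
  simp [qPoch, ha]

theorem qPoch_mul_inv {a : R} (ha : PowerSeries.constantCoeff a = 0) (n : ℕ) :
    qPoch a q n * (qPoch a q n)⁻¹ = 1 :=
  PowerSeries.mul_inv_cancel _ (by simp [constantCoeff_qPoch ha])

theorem qPoch_mul_qFactInv (n : ℕ) : qPoch q q n * qFactInv n = 1 :=
  qPoch_mul_inv constantCoeff_q n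

theorem qFactInv_zero : qFactInv 0 = 1 := by
  simpa [qPoch_zero] using qPoch_mul_qFactInv 0

theorem one_sub_q_pow_mul_qFactInv (n : ℕ) :
    (1 - q ^ (n + 1)) * qFactInv (n + 1) = qFactInv n := by
  have h := qPoch_mul_qFactInv (n + 1)
  have h' := qPoch_mul_qFactInv n
  rw [qPoch_succ, ← pow_succ'] at h
  linear_combination (-(1 - q ^ (n + 1)) * qFactInv (n + 1)) * h' + qFactInv n * h

theorem one_sub_q_pow_ne_zero (n : ℕ) : (1 - q ^ (n + 1) : R) ≠ 0 := by
  intro h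
  have := congrArg PowerSeries.constantCoeff h
  simp [constantCoeff_q] at this

/-- The `q`-binomial theorem. -/
theorem sum_antidiagonal_qBinomial (x y : R) (n : ℕ) :
    ∑ p ∈ antidiagonal n, q ^ (p.2.choose 2) * x ^ p.1 * y ^ p.2 *
      (qFactInv p.1 * qFactInv p.2) = (∏ s ∈ range n, (x + y * q ^ s)) * qFactInv n := by
  induction n with
  | zero => simp [qFactInv_zero]
  | succ n ih =>
    apply mul_left_cancel₀ (one_sub_q_pow_ne_zero n)
    -- The q-Pascal rule, in the form `1 - q^(i+j) = (1 - q^i) + q^i (1 - q^j)`; each factor cancels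
    -- one step of an inverse q-factorial.
    have hsplit : (1 - q ^ (n + 1)) * ∑ p ∈ antidiagonal (n + 1),
        q ^ (p.2.choose 2) * x ^ p.1 * y ^ p.2 * (qFactInv p.1 * qFactInv p.2) =
        ∑ p ∈ antidiagonal (n + 1), q ^ (p.2.choose 2) * x ^ p.1 * y ^ p.2 *
          (((1 - q ^ p.1) * qFactInv p.1) * qFactInv p.2) +
        ∑ p ∈ antidiagonal (n + 1), q ^ (p.2.choose 2) * x ^ p.1 * y ^ p.2 *
          (q ^ p.1 * qFactInv p.1 * ((1 - q ^ p.2) * qFactInv p.2)) := by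
      rw [mul_sum, ← sum_add_distrib]
      refine sum_congr rfl fun p hp => ?_
      rw [← mem_antidiagonal.1 hp, pow_add]
      ring
    rw [hsplit, Finset.Nat.sum_antidiagonal_succ, Finset.Nat.sum_antidiagonal_succ', prod_range_succ]
    simp only [one_sub_q_pow_mul_qFactInv, pow_zero, sub_self, zero_mul, mul_zero, zero_add]
    have h1 : ∑ p ∈ antidiagonal n, q ^ (p.2.choose 2) * x ^ (p.1 + 1) * y ^ p.2 *
        (qFactInv p.1 * qFactInv p.2) = x * ((∏ s ∈ range n, (x + y * q ^ s)) * qFactInv n) := by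
      rw [← ih, mul_sum]
      exact sum_congr rfl fun p _ => by ring
    have h2 : ∑ p ∈ antidiagonal n, q ^ ((p.2 + 1).choose 2) * x ^ p.1 * y ^ (p.2 + 1) *
        (q ^ p.1 * qFactInv p.1 * qFactInv p.2) =
        y * q ^ n * ((∏ s ∈ range n, (x + y * q ^ s)) * qFactInv n) := by
      rw [← ih, mul_sum]
      refine sum_congr rfl fun p hp => ?_
      rw [← mem_antidiagonal.1 hp, Nat.choose_succ_succ' p.2 1, Nat.choose_one_right, pow_add,
        pow_add]
      ring
    rw [h1, h2]
    linear_combination -((∏ s ∈ range n, (x + y * q ^ s)) * (x + y * q ^ n)) *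
      one_sub_q_pow_mul_qFactInv n

/-! ### The infinite product as a limit, and Euler's expansion -/

theorem tendsto_of_eventually_coeff_eq {f : ℕ → R⟦X⟧} {g : R⟦X⟧}
    (h : ∀ n m, ∀ᶠ N in Filter.atTop,
      PowerSeries.coeff m (PowerSeries.coeff n (f N)) = PowerSeries.coeff m (PowerSeries.coeff n g)) :
    Filter.Tendsto f Filter.atTop (nhds g) := by
  rw [PowerSeries.WithPiTopology.tendsto_iff_coeff_tendsto]
  intro n
  rw [PowerSeries.WithPiTopology.tendsto_iff_coeff_tendsto]
  intro m
  exact tendsto_nhds_of_eventually_eq (h n m)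

/-- A sequence of power series with `f (N + 1) = (1 - u q ^ N) f N` tends to `(u; q)_∞ f 0`. -/
theorem eq_uPochInf_mul {f : ℕ → R⟦X⟧} {g : R⟦X⟧}
    (hf : ∀ N, f (N + 1) = (1 - u * (PowerSeries.C q) ^ N) * f N)
    (h : ∀ n m, ∀ᶠ N in Filter.atTop,
      PowerSeries.coeff m (PowerSeries.coeff n (f N)) =
        PowerSeries.coeff m (PowerSeries.coeff n g)) :
    g = uPochInf * f 0 := by
  have : DiscreteTopology K := ⟨rfl⟩
  have hprod : ∀ N, f N = (∏ i ∈ range N, (1 - u * (PowerSeries.C q) ^ i)) * f 0 := by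
    intro N
    induction N with
    | zero => simp
    | succ N ih => rw [hf, ih, prod_range_succ]; ring
  have h1 := (multipliable_uPochInf.tendsto_prod_tprod_nat).mul_const (f 0)
  refine tendsto_nhds_unique (tendsto_of_eventually_coeff_eq h) ?_
  exact h1.congr fun N => (hprod N).symm

/-- Euler's expansion of the inverse of `(u; q)_∞`. -/
theorem uPochInf_mul_mk_qFactInv : uPochInf * PowerSeries.mk qFactInv = 1 := by
  symm
  -- `f N` is the Euler series with `u` replaced by `u q^N`; it tends to its constant term `1`.
  have h := eq_uPochInf_mul
    (f := fun N => PowerSeries.mk fun n => (q ^ N) ^ n * qFactInv n) (g := 1) ?_ ?_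
  · simpa using h
  · intro N
    ext1 n
    have hu : u * PowerSeries.C q ^ N = PowerSeries.C (q ^ N) * PowerSeries.X := by
      rw [map_pow, mul_comm]; rfl
    rw [sub_mul, one_mul, hu, mul_assoc, map_sub, PowerSeries.coeff_C_mul]
    cases n with
    | zero => simp
    | succ n =>
      rw [PowerSeries.coeff_succ_X_mul]
      simp only [PowerSeries.coeff_mk, ← one_sub_q_pow_mul_qFactInv n]
      ring
  · intro n m
    cases n with
    | zero => simp [qFactInv_zero]
    | succ n =>
      filter_upwards [Filter.eventually_gt_atTop m] with N hN
      rw [PowerSeries.coeff_mk, ← pow_mul, q, PowerSeries.coeff_X_pow_mul', if_neg (by nlinarith)]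
      simp [PowerSeries.coeff_one]

/-! ### Words over the natural numbers and their fixed letters -/

/-- The word `x` has an occurrence of the letter `c` whose position is that of the same occurrence
in the weakly decreasing rearrangement of `x`, the occurrences of each letter being kept in order. -/
def FixedAt (c : ℕ) (x : List ℕ) : Prop :=
  ∃ a b, x = a ++ c :: b ∧ a.countP (· ≠ c) = x.countP (c < ·)

theorem FixedAt.mem {c : ℕ} {x : List ℕ} (h : FixedAt c x) : c ∈ x := by
  obtain ⟨a, b, rfl, -⟩ := h
  simp

theorem countP_ne_add_count (c : ℕ) (x : List ℕ) :
    x.countP (· ≠ c) + x.count c = x.length := by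
  rw [List.length_eq_countP_add_countP (· == c), List.count, add_comm]
  congr 1
  exact List.countP_congr fun _ _ => by simp

theorem countP_lt_add_count_le {c d : ℕ} (h : c < d) (x : List ℕ) :
    x.countP (d < ·) + x.count d ≤ x.countP (c < ·) := by
  induction x with
  | nil => simp
  | cons a x ih =>
    simp only [List.countP_cons, List.count_cons, decide_eq_true_eq, beq_iff_eq]
    split_ifs <;> omega

theorem countP_lt_append_cons (c d : ℕ) (a b : List ℕ) :
    (a ++ d :: b).countP (c < ·) = (a ++ b).countP (c < ·) + if c < d then 1 else 0 := by
  simp only [List.countP_append, List.countP_cons, decide_eq_true_eq]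
  omega

theorem eq_replicate_of_countP_ne_eq_zero {c : ℕ} {m : List ℕ} (h : m.countP (· ≠ c) = 0) :
    m = List.replicate m.length c := by
  rw [List.countP_eq_zero] at h
  exact List.eq_replicate_of_mem fun b hb => by simpa using h b hb

theorem append_cons_eq_append_cons {α : Type*} {a b a' b' : List α} {c d : α}
    (h : a ++ c :: b = a' ++ d :: b') :
    (a = a' ∧ c = d ∧ b = b') ∨ (∃ m, a' = a ++ c :: m ∧ b = m ++ d :: b') ∨
      ∃ m, a = a' ++ d :: m ∧ b' = m ++ c :: b := by
  rcases List.append_eq_append_iff.1 h with ⟨m, h1, h2⟩ | ⟨m, h1, h2⟩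
  · cases m with
    | nil => simp_all
    | cons e m => simp_all
  · cases m with
    | nil => simp_all
    | cons e m => simp_all

/-- Inserting `c` as a fixed letter moves an occurrence of `d` and its sorted position by the same
amount when `d < c` lies to the right of `c` or `d > c` lies to the left. In the two other cases the
occurrence is on the wrong side of `c`, hence fixed neither before nor after: a smaller letter on
the left stands too early, a larger one on the right too late. -/
theorem fixedAt_append_cons_iff {c d : ℕ} (hcd : d ≠ c) {a b : List ℕ}
    (hc : a.countP (· ≠ c) = (a ++ b).countP (c < ·)) :
    FixedAt d (a ++ c :: b) ↔ FixedAt d (a ++ b) := by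
  have hG := countP_ne_add_count c a
  have left : ∀ a₁ a₂, a = a₁ ++ d :: a₂ →
      (a₁.countP (· ≠ d) = (a ++ c :: b).countP (d < ·) ↔
        a₁.countP (· ≠ d) = (a ++ b).countP (d < ·)) := by
    rintro a₁ a₂ rfl
    rw [countP_lt_append_cons]
    split_ifs with h
    · have h1 := countP_lt_add_count_le h ((a₁ ++ d :: a₂) ++ b)
      have h2 : a₁.countP (· ≠ d) ≤ a₁.length := List.countP_le_length
      simp only [List.length_append, List.length_cons, List.count_append] at *
      omega
    · simp
  have right : ∀ b₁ b₂, b = b₁ ++ d :: b₂ →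
      ((a ++ c :: b₁).countP (· ≠ d) = (a ++ c :: b).countP (d < ·) ↔
        (a ++ b₁).countP (· ≠ d) = (a ++ b).countP (d < ·)) := by
    rintro b₁ b₂ rfl
    have h0 : (a ++ c :: b₁).countP (· ≠ d) = (a ++ b₁).countP (· ≠ d) + 1 := by
      simp [List.countP_append, hcd.symm]
      omega
    rw [countP_lt_append_cons, h0]
    rcases lt_or_gt_of_ne hcd with h | h
    · simp [h]
    · have h1 := countP_lt_add_count_le h (a ++ (b₁ ++ d :: b₂))
      have h2 := countP_ne_add_count d (a ++ b₁)
      simp only [List.length_append, List.count_append, List.count_cons, beq_self_eq_true,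
        if_true] at *
      rw [if_neg h.not_gt]
      omega
  constructor
  · rintro ⟨a', b', h, hx⟩
    rcases append_cons_eq_append_cons h with ⟨-, h2, -⟩ | ⟨m, rfl, hb⟩ | ⟨m, ha, rfl⟩
    · exact absurd h2.symm hcd
    · refine ⟨a ++ m, b', by simp [hb], ?_⟩
      exact (right m b' hb).1 hx
    · refine ⟨a', m ++ b, by simp [ha], ?_⟩
      exact (left a' m ha).1 hx
  · rintro ⟨a', b', h, hx⟩
    rcases List.append_eq_append_iff.1 h with ⟨m, rfl, hb⟩ | ⟨m, ha, hm⟩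
    · refine ⟨a ++ c :: m, b', by simp [hb], ?_⟩
      exact (right m b' hb).2 hx
    · cases m with
      | nil =>
        simp only [List.nil_append, List.append_nil] at ha hm
        subst ha
        exact ⟨a ++ [c], b', by simp [hm], (right [] b' (by simp [hm])).2 (by simpa using hx)⟩
      | cons e m =>
        obtain ⟨rfl, rfl⟩ := List.cons.inj hm
        exact ⟨a', m ++ c :: b, by simp [ha], (left a' m ha).2 hx⟩

/-- The letter `c` can be inserted as a fixed letter in exactly one way. -/
theorem append_cons_unique {c : ℕ} {a b a' b' : List ℕ} (h : a ++ b = a' ++ b')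
    (hc : a.countP (· ≠ c) = a'.countP (· ≠ c)) : a ++ c :: b = a' ++ c :: b' := by
  have aux : ∀ m b' : List ℕ, m.countP (· ≠ c) = 0 → c :: (m ++ b') = m ++ c :: b' := by
    intro m b' hm
    rw [eq_replicate_of_countP_ne_eq_zero hm, ← List.cons_append, ← List.replicate_succ,
      List.replicate_succ', List.append_assoc]
    rfl
  rcases List.append_eq_append_iff.1 h with ⟨m, rfl, rfl⟩ | ⟨m, rfl, rfl⟩
  · rw [List.countP_append] at hc
    rw [aux m b' (by omega), List.append_assoc]
  · rw [List.countP_append] at hc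
    rw [List.append_assoc, aux m b (by omega)]

/-- Several occurrences of `c` may be fixed at once, but only copies of `c` lie between them, so
deleting any one of them leaves the same word. -/
theorem append_eq_of_append_cons_eq {c : ℕ} {a b a' b' : List ℕ}
    (h : a ++ c :: b = a' ++ c :: b') (hc : a.countP (· ≠ c) = a'.countP (· ≠ c)) :
    a ++ b = a' ++ b' := by
  have aux : ∀ m b' : List ℕ, m.countP (· ≠ c) = 0 → m ++ c :: b' = c :: (m ++ b') := by
    intro m b' hm
    rw [eq_replicate_of_countP_ne_eq_zero hm, ← List.cons_append, ← List.replicate_succ,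
      List.replicate_succ', List.append_assoc]
    rfl
  rcases append_cons_eq_append_cons h with ⟨rfl, -, rfl⟩ | ⟨m, rfl, rfl⟩ | ⟨m, rfl, rfl⟩
  · rfl
  · rw [List.countP_append, List.countP_cons] at hc
    rw [aux m b' (by omega), List.append_assoc, List.cons_append]
  · rw [List.countP_append, List.countP_cons] at hc
    rw [aux m b (by omega), List.append_assoc, List.cons_append]

theorem exists_append_countP_eq {α : Type*} (p : α → Bool) (x : List α) {k : ℕ}
    (hk : k ≤ x.countP p) : ∃ a b, x = a ++ b ∧ a.countP p = k := by
  induction x generalizing k with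
  | nil => exact ⟨[], [], by simp_all⟩
  | cons e x ih =>
    cases k with
    | zero => exact ⟨[], e :: x, by simp⟩
    | succ k =>
      rw [List.countP_cons] at hk
      by_cases he : p e
      · obtain ⟨a, b, rfl, h⟩ := ih (k := k) (by simp [he] at hk; omega)
        exact ⟨e :: a, b, rfl, by simp [he, h]⟩
      · obtain ⟨a, b, rfl, h⟩ := ih (k := k + 1) (by simpa [he] using hk)
        exact ⟨e :: a, b, rfl, by simp [he, h]⟩

theorem exists_insertion (c : ℕ) (y : List ℕ) :
    ∃ s : List ℕ × List ℕ, y = s.1 ++ s.2 ∧ s.1.countP (· ≠ c) = y.countP (c < ·) := by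
  obtain ⟨a, b, h⟩ := exists_append_countP_eq (· ≠ c) y (k := y.countP (c < ·))
    (List.countP_mono_left fun e _ h => by simp at h ⊢; omega)
  exact ⟨(a, b), h⟩

/-- The words of length `n` over `ℕ` with sum `m`. -/
def words (n m : ℕ) : Finset (List ℕ) :=
  (Finset.Nat.antidiagonalTuple n m).map ⟨List.ofFn, List.ofFn_injective⟩

theorem mem_words {n m : ℕ} {x : List ℕ} : x ∈ words n m ↔ x.length = n ∧ x.sum = m := by
  simp only [words, Finset.mem_map, Finset.Nat.mem_antidiagonalTuple, Function.Embedding.coeFn_mk]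
  constructor
  · rintro ⟨f, hf, rfl⟩
    simp [List.sum_ofFn, hf]
  · rintro ⟨rfl, rfl⟩
    exact ⟨x.get, by rw [← List.sum_ofFn, List.ofFn_get], List.ofFn_get x⟩

open Classical in
/-- The generating series, by the sum of the letters, of the words of length `n` without fixed
letters in `T`. -/
def freeSeries (T : Set ℕ) (n : ℕ) : R :=
  PowerSeries.mk fun m => ((words n m).filter fun x => ∀ c ∈ T, ¬ FixedAt c x).card

-- Among the words counted by `T`, those in which `c` is fixed correspond, by deleting a fixed `c`,
-- to all words counted by `T` of length one less; `c` may or may not be fixed in the shorter word.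
open Classical in
theorem freeSeries_insert {T : Set ℕ} {c : ℕ} (hc : c ∉ T) (n : ℕ) :
    freeSeries T (n + 1) = freeSeries (insert c T) (n + 1) + q ^ c * freeSeries T n := by
  ext1 m
  simp only [freeSeries, map_add, PowerSeries.coeff_mk, q, PowerSeries.coeff_X_pow_mul']
  have h1 := Finset.card_filter_add_card_filter_not (s := (words (n + 1) m).filter
    fun x => ∀ d ∈ T, ¬ FixedAt d x) (fun x => FixedAt c x)
  have h2 : (((words (n + 1) m).filter fun x => ∀ d ∈ T, ¬ FixedAt d x).filter
      fun x => ¬ FixedAt c x) =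
      (words (n + 1) m).filter fun x => ∀ d ∈ insert c T, ¬ FixedAt d x := by
    ext x
    simp only [mem_filter, Set.forall_mem_insert]
    tauto
  have h3 : (((words (n + 1) m).filter fun x => ∀ d ∈ T, ¬ FixedAt d x).filter
      fun x => FixedAt c x).card = if c ≤ m then
        ((words n (m - c)).filter fun x => ∀ d ∈ T, ¬ FixedAt d x).card else 0 := by
    split_ifs with hm
    -- The place of insertion need not be unique, but the resulting word is, so any choice of
    -- splitting defines the bijection.
    · choose s hs using exists_insertion c
      symm
      refine Finset.card_bij (fun y _ => (s y).1 ++ c :: (s y).2) ?_ ?_ ?_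
      · intro y hy
        rw [mem_filter, mem_words] at hy
        obtain ⟨⟨hy1, hy2⟩, hy3⟩ := hy
        obtain ⟨hs1, hs2⟩ := hs y
        simp only [mem_filter, mem_words]
        refine ⟨⟨⟨?_, ?_⟩, fun d hd => ?_⟩, _, _, rfl, ?_⟩
        · rw [hs1] at hy1
          simp only [List.length_append, List.length_cons] at *
          omega
        · rw [hs1] at hy2
          simp only [List.sum_append, List.sum_cons] at *
          omega
        · rw [fixedAt_append_cons_iff (by rintro rfl; exact hc hd) (by rw [← hs1]; exact hs2),
            ← hs1]
          exact hy3 d hd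
        · rw [countP_lt_append_cons, ← hs1, hs2]
          simp
      · intro y _ y' _ h
        rw [(hs y).1, (hs y').1]
        refine append_eq_of_append_cons_eq h ?_
        have := congrArg (List.countP (c < ·)) h
        rw [countP_lt_append_cons, countP_lt_append_cons, ← (hs y).1, ← (hs y').1] at this
        rw [(hs y).2, (hs y').2]
        omega
      · intro x hx
        simp only [mem_filter, mem_words] at hx
        obtain ⟨⟨⟨hx1, hx2⟩, hx3⟩, a, b, rfl, hab⟩ := hx
        rw [countP_lt_append_cons, if_neg (lt_irrefl c), add_zero] at hab
        refine ⟨a ++ b, ?_, ?_⟩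
        · simp only [mem_filter, mem_words]
          refine ⟨⟨?_, ?_⟩, fun d hd => ?_⟩
          · simp only [List.length_append, List.length_cons] at *
            omega
          · simp only [List.sum_append, List.sum_cons] at *
            omega
          · rw [← fixedAt_append_cons_iff (by rintro rfl; exact hc hd) hab]
            exact hx3 d hd
        · exact append_cons_unique (hs _).1.symm ((hs _).2.trans hab.symm)
    · rw [Finset.card_eq_zero, Finset.filter_eq_empty_iff]
      intro x hx h
      rw [mem_filter, mem_words] at hx
      exact hm (hx.1.2 ▸ List.single_le_sum (by simp) _ h.mem)
  rw [h2, h3] at h1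
  rw [← h1]
  split_ifs <;> push_cast <;> ring

theorem freeSeries_zero (T : Set ℕ) : freeSeries T 0 = 1 := by
  classical
  ext1 m
  rw [freeSeries, PowerSeries.coeff_mk, PowerSeries.coeff_one]
  have h : ((words 0 m).filter fun x => ∀ c ∈ T, ¬ FixedAt c x) = if m = 0 then {[]} else ∅ := by
    ext x
    rw [mem_filter, mem_words]
    split_ifs with h
    · subst h
      simp only [List.length_eq_zero_iff, mem_singleton]
      constructor
      · exact fun h => h.1.1
      · rintro rfl
        exact ⟨by simp, fun c _ h => by simpa using h.mem⟩
    · simp only [List.length_eq_zero_iff, notMem_empty, iff_false]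
      rintro ⟨⟨rfl, rfl⟩, -⟩
      simp at h
  rw [h]
  split_ifs <;> simp

theorem mk_freeSeries_insert {T : Set ℕ} {c : ℕ} (hc : c ∉ T) :
    PowerSeries.mk (freeSeries (insert c T)) =
      (1 - u * (PowerSeries.C q) ^ c) * PowerSeries.mk (freeSeries T) := by
  have hu : u * PowerSeries.C q ^ c = PowerSeries.C (q ^ c) * PowerSeries.X := by
    rw [map_pow, mul_comm]; rfl
  ext1 n
  rw [sub_mul, one_mul, hu, mul_assoc, map_sub, PowerSeries.coeff_C_mul]
  cases n with
  | zero => simp [freeSeries_zero]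
  | succ n =>
    rw [PowerSeries.coeff_succ_X_mul, PowerSeries.coeff_mk, PowerSeries.coeff_mk,
      PowerSeries.coeff_mk, freeSeries_insert hc, add_sub_cancel_right]

/-- Forbid the letters `0, 1, 2, …` one after another. A fixed letter is at most the sum of the
word, so the coefficient of `q^m` no longer changes once all letters up to `m` are forbidden. -/
theorem mk_freeSeries_univ :
    PowerSeries.mk (freeSeries Set.univ) = uPochInf * PowerSeries.mk (freeSeries ∅) := by
  classical
  have h := eq_uPochInf_mul (f := fun N => PowerSeries.mk (freeSeries (Set.Iio N)))
    (g := PowerSeries.mk (freeSeries Set.univ)) ?_ ?_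
  · rw [h]
    congr 3
    ext; simp
  · intro N
    rw [← mk_freeSeries_insert (by simp)]
    congr 2
    ext; simp
  · intro n m
    filter_upwards [Filter.eventually_gt_atTop m] with N hN
    simp only [PowerSeries.coeff_mk, freeSeries]
    congr 2
    refine Finset.filter_congr fun x hx => ?_
    rw [mem_words] at hx
    refine ⟨fun h c _ hcx => h c ?_ hcx, fun h c _ => h c trivial⟩
    exact lt_of_le_of_lt (hx.2 ▸ List.single_le_sum (by simp) _ hcx.mem) hN

theorem mk_one_eq : (PowerSeries.mk 1 : R) = (1 - q)⁻¹ := by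
  have h : (1 - q : R) * (1 - q)⁻¹ = 1 := PowerSeries.mul_inv_cancel _ (by simp [constantCoeff_q])
  have h' : (PowerSeries.mk 1 : R) * (1 - q) = 1 := PowerSeries.mk_one_mul_one_sub_eq_one K
  linear_combination (1 - q)⁻¹ * h' - PowerSeries.mk 1 * h

theorem coeff_prod_fin {n : ℕ} (f : Fin n → R) (m : ℕ) :
    PowerSeries.coeff m (∏ i, f i) =
      ∑ l ∈ Finset.Nat.antidiagonalTuple n m, ∏ i, PowerSeries.coeff (l i) (f i) := by
  rw [PowerSeries.coeff_prod]
  refine Finset.sum_nbij' (fun l => ⇑l) Finsupp.equivFunOnFinite.symm ?_ ?_ ?_ ?_ ?_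
  · intro l hl
    simpa [Finset.Nat.mem_antidiagonalTuple] using hl
  · intro l hl
    simpa [Finset.Nat.mem_antidiagonalTuple] using hl
  · intro l _
    ext; simp
  · intro l _
    ext; simp
  · intro l _
    rfl

theorem freeSeries_empty (n : ℕ) : freeSeries ∅ n = ((1 - q)⁻¹ : R) ^ n := by
  have h := coeff_prod_fin (fun _ : Fin n => (PowerSeries.mk 1 : R))
  simp only [prod_const, card_univ, Fintype.card_fin, PowerSeries.coeff_mk, Pi.one_apply, one_pow] at h
  rw [← mk_one_eq]
  ext1 m
  rw [h, freeSeries]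
  simp [words]

/-! ### Fixed letters of a word and fixed points of its sorting permutation -/

theorem countP_ofFn {α : Type*} {n : ℕ} (g : Fin n → α) (p : α → Prop) [DecidablePred p] :
    (List.ofFn g).countP (p ·) = #{k | p (g k)} := by
  rw [List.ofFn_eq_map, List.countP_map, List.countP_eq_length_filter]
  simp [Finset.card, Finset.filter, Fin.univ_def, Function.comp_def]

theorem countP_take_ofFn {α : Type*} {n : ℕ} (g : Fin n → α) (p : α → Prop) [DecidablePred p]
    (j : Fin n) : ((List.ofFn g).take j).countP (p ·) = #{k | k < j ∧ p (g k)} := by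
  rw [← Fin.ofFn_take_eq_take_ofFn j.2.le, countP_ofFn]
  refine Finset.card_bij (fun k _ => Fin.castLE j.2.le k) ?_ ?_ ?_
  · intro k hk
    simp only [mem_filter, mem_univ, true_and] at hk ⊢
    exact ⟨k.2, hk⟩
  · intro k _ k' _ h
    exact Fin.castLE_injective _ h
  · intro k hk
    simp only [mem_filter, mem_univ, true_and] at hk
    exact ⟨⟨k, hk.1⟩, by rw [mem_filter]; exact ⟨mem_univ _, hk.2⟩, rfl⟩

theorem fixedAt_ofFn {n : ℕ} (g : Fin n → ℕ) (c : ℕ) :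
    FixedAt c (List.ofFn g) ↔ ∃ j, g j = c ∧ #{k | k < j ∧ g k ≠ c} = #{k | c < g k} := by
  constructor
  · rintro ⟨a, b, h, hc⟩
    have hlen : a.length < n := by
      have := congrArg List.length h
      simp at this
      omega
    refine ⟨⟨a.length, hlen⟩, ?_, ?_⟩
    · have : (List.ofFn g)[a.length]? = some c := by rw [h]; simp
      simpa [List.getElem?_ofFn, hlen] using this
    · rw [← countP_take_ofFn g (· ≠ c), ← countP_ofFn g (c < ·), ← hc, h]
      simp
  · rintro ⟨j, rfl, h⟩
    refine ⟨(List.ofFn g).take j, (List.ofFn g).drop (j + 1), ?_, ?_⟩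
    · have hj : (j : ℕ) < (List.ofFn g).length := by simp
      have : g j = (List.ofFn g)[(j : ℕ)] := by simp
      rw [this, List.cons_getElem_drop_succ, List.take_append_drop]
    · rw [countP_take_ofFn g (· ≠ g j), countP_ofFn g (g j < ·), h]

/-- In the stable decreasing sort, a letter is preceded by the larger letters and by the earlier
equal ones. `OrderDual` turns the increasing `Tuple.sort` into a decreasing one. -/
theorem card_filter_sort {n : ℕ} (g : Fin n → ℕ) {σ : Equiv.Perm (Fin n)}
    (hσ : Tuple.sort (OrderDual.toDual ∘ g) = σ) (i : Fin n) :
    #{k | g (σ i) < g k} + #{k | k < σ i ∧ g k = g (σ i)} = i := by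
  obtain ⟨hm, ht⟩ := Tuple.eq_sort_iff.1 hσ.symm
  have hanti : ∀ a b, a ≤ b → g (σ b) ≤ g (σ a) := fun a b h => hm h
  have ht' : ∀ a b, a < b → g (σ a) = g (σ b) → σ a < σ b := fun a b h h' => ht a b h h'
  have hcard : #(Finset.Iio i) = (i : ℕ) := Fin.card_Iio i
  rw [← hcard, ← card_union_of_disjoint]
  · symm
    refine Finset.card_bij (fun k _ => σ k) ?_ (fun _ _ _ _ h => σ.injective h) ?_
    · intro k hk
      rw [mem_Iio] at hk
      simp only [mem_union, mem_filter, mem_univ, true_and]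
      rcases (hanti k i hk.le).lt_or_eq with h | h
      · exact Or.inl h
      · exact Or.inr ⟨ht' k i hk h.symm, h.symm⟩
    · intro k hk
      obtain ⟨k, rfl⟩ := σ.surjective k
      simp only [mem_union, mem_filter, mem_univ, true_and] at hk
      refine ⟨k, ?_, rfl⟩
      rw [mem_Iio]
      by_contra hik
      rw [not_lt] at hik
      rcases hk with h | ⟨h1, h2⟩
      · exact absurd (hanti i k hik) (by omega)
      · rcases hik.lt_or_eq with h | rfl
        · exact absurd (ht' i k h h2.symm) h1.not_gt
        · exact lt_irrefl _ h1
  · rw [disjoint_filter]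
    intro k _ h h'
    omega

theorem forall_not_fixedAt_iff {n : ℕ} (g : Fin n → ℕ) {σ : Equiv.Perm (Fin n)}
    (hσ : Tuple.sort (OrderDual.toDual ∘ g) = σ) :
    (∀ c, ¬ FixedAt c (List.ofFn g)) ↔ σ ∈ derangements (Fin n) := by
  -- The position `σ i` counts the earlier letters, equal or not; the sorted position `i` counts the
  -- larger letters and the earlier equal ones. The equal ones cancel.
  have key : ∀ i, σ i = i ↔ #{k | k < σ i ∧ g k ≠ g (σ i)} = #{k | g (σ i) < g k} := by
    intro i
    have h1 := card_filter_sort g hσ i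
    have h2 := Finset.card_filter_add_card_filter_not (s := Finset.Iio (σ i))
      (fun k => g k = g (σ i))
    rw [Fin.card_Iio] at h2
    have h3 : ∀ p : Fin n → Prop, ∀ [DecidablePred p], (Finset.Iio (σ i)).filter p =
        ({k | k < σ i ∧ p k} : Finset (Fin n)) := by
      intro p _
      ext k
      simp
    rw [h3, h3] at h2
    rw [Fin.ext_iff]
    simp only [ne_eq]
    omega
  simp only [fixedAt_ofFn]
  constructor
  · intro h i hi
    exact h (g (σ i)) ⟨σ i, rfl, (key i).1 hi⟩
  · rintro h c ⟨j, rfl, hj⟩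
    obtain ⟨i, rfl⟩ := σ.surjective j
    exact h i ((key i).2 hj)

/-! ### Words with a given sorting permutation, and the major index -/

/-- The indicator function of the descents of a permutation. -/
def desc {n : ℕ} (σ : Equiv.Perm (Fin n)) (i : Fin n) : ℕ :=
  if h : (i : ℕ) + 1 < n then (if σ i > σ ⟨(i : ℕ) + 1, h⟩ then 1 else 0) else 0

theorem maj_eq_sum_desc {n : ℕ} (σ : Equiv.Perm (Fin n)) :
    maj σ = ∑ i : Fin n, ((i : ℕ) + 1) * desc σ i := by
  refine sum_congr rfl fun i _ => ?_
  simp only [desc]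
  split_ifs <;> simp

/-- The weakly decreasing sequence with differences `a i + desc σ i`. -/
def partialSums {n : ℕ} (σ : Equiv.Perm (Fin n)) (a : Fin n → ℕ) (i : Fin n) : ℕ :=
  ∑ j with i ≤ j, (a j + desc σ j)

theorem partialSums_eq {n : ℕ} (σ : Equiv.Perm (Fin n)) (a : Fin n → ℕ) (i : Fin n) :
    partialSums σ a i = a i + desc σ i +
      if h : (i : ℕ) + 1 < n then partialSums σ a ⟨(i : ℕ) + 1, h⟩ else 0 := by
  have h : univ.filter (i ≤ ·) = insert i (univ.filter (i < ·)) := by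
    ext j
    simp [le_iff_eq_or_lt, eq_comm]
  rw [partialSums, h, sum_insert (by simp)]
  congr 1
  split_ifs with h
  · rfl
  · refine sum_eq_zero fun j hj => ?_
    simp only [mem_filter, mem_univ, true_and, Fin.lt_def] at hj
    omega

theorem sum_partialSums {n : ℕ} (σ : Equiv.Perm (Fin n)) (a : Fin n → ℕ) :
    ∑ i, partialSums σ a i = ∑ i : Fin n, ((i : ℕ) + 1) * a i + maj σ := by
  simp only [partialSums, sum_filter]
  rw [sum_comm, maj_eq_sum_desc, ← sum_add_distrib]
  refine sum_congr rfl fun j _ => ?_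
  rw [← sum_filter, sum_const]
  have : #({i | i ≤ j} : Finset (Fin n)) = (j : ℕ) + 1 := by
    rw [← Fin.card_Iic j]
    congr 1
    ext; simp
  rw [this, smul_eq_mul, mul_add]

theorem lt_of_desc_eq_zero {n : ℕ} {σ : Equiv.Perm (Fin n)} {i j : Fin n} (hij : i < j)
    (h : ∀ k, i ≤ k → k < j → desc σ k = 0) : σ i < σ j := by
  obtain ⟨i, hi⟩ := i
  obtain ⟨j, hj⟩ := j
  simp only [Fin.le_def, Fin.lt_def] at hij h
  induction j, hij using Nat.le_induction with
  | base =>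
    have := h ⟨i, hi⟩ le_rfl (Nat.lt_succ_self i)
    simp only [desc, hj, dite_true] at this
    refine lt_of_le_of_ne (not_lt.1 fun h => by simp [h] at this) fun h => ?_
    simpa using σ.injective h
  | succ j hij ih =>
    refine (ih (by omega) fun k h1 h2 => h k h1 (by omega)).trans ?_
    have := h ⟨j, by omega⟩ (by simp only; omega) (Nat.lt_succ_self j)
    simp only [desc, hj, dite_true] at this
    refine lt_of_le_of_ne (not_lt.1 fun h => by simp [h] at this) fun h => ?_
    simpa using σ.injective h

/-- The values drop strictly at each descent of `σ`, so `σ` increases along any run of equal values,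
which is what stability of the sort demands. -/
theorem sort_partialSums {n : ℕ} (σ : Equiv.Perm (Fin n)) (a : Fin n → ℕ) :
    Tuple.sort (OrderDual.toDual ∘ (partialSums σ a ∘ σ.symm)) = σ := by
  symm
  rw [Tuple.eq_sort_iff]
  have hsplit : ∀ i j : Fin n, i ≤ j → partialSums σ a i =
      partialSums σ a j + ∑ k with i ≤ k ∧ k < j, (a k + desc σ k) := by
    intro i j hij
    rw [partialSums, partialSums, ← sum_union]
    · congr 1
      ext k
      simp only [mem_filter, mem_univ, true_and, mem_union]
      rcases le_or_gt j k with h | h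
      · simp [h, hij.trans h]
      · simp [h, h.not_ge]
    · rw [disjoint_filter]
      intro k _ h h'
      exact absurd h h'.2.not_ge
  constructor
  · intro i j hij
    simp only [Function.comp_apply, Equiv.symm_apply_apply, OrderDual.toDual_le_toDual]
    have := hsplit i j hij
    omega
  · intro i j hij h
    simp only [Function.comp_apply, Equiv.symm_apply_apply, OrderDual.toDual_inj] at h
    have h0 : ∑ k with i ≤ k ∧ k < j, (a k + desc σ k) = 0 := by
      have := hsplit i j hij.le
      omega
    refine lt_of_desc_eq_zero hij fun k h1 h2 => ?_
    have := (sum_eq_zero_iff.1 h0) k (by simp [h1, h2])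
    omega

theorem partialSums_injective {n : ℕ} (σ : Equiv.Perm (Fin n)) :
    Function.Injective (partialSums σ) := by
  intro a b h
  funext i
  have h1 := partialSums_eq σ a i
  have h2 := partialSums_eq σ b i
  rw [h] at h1
  omega

theorem exists_partialSums_eq {n : ℕ} {σ : Equiv.Perm (Fin n)} {g : Fin n → ℕ}
    (hσ : Tuple.sort (OrderDual.toDual ∘ g) = σ) : ∃ a, partialSums σ a = g ∘ σ := by
  obtain ⟨hm, ht⟩ := Tuple.eq_sort_iff.1 hσ.symm
  let next : Fin n → ℕ := fun i => if h : (i : ℕ) + 1 < n then g (σ ⟨(i : ℕ) + 1, h⟩) else 0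
  have hle : ∀ i, desc σ i + next i ≤ g (σ i) := by
    intro i
    simp only [desc, next]
    split_ifs with h h'
    · have h1 : g (σ ⟨(i : ℕ) + 1, h⟩) ≤ g (σ i) := hm (by simp [Fin.le_def])
      have h2 : g (σ i) ≠ g (σ ⟨(i : ℕ) + 1, h⟩) := fun h2 =>
        absurd (ht i ⟨(i : ℕ) + 1, h⟩ (by simp [Fin.lt_def]) h2) h'.not_gt
      omega
    · have h1 : g (σ ⟨(i : ℕ) + 1, h⟩) ≤ g (σ i) := hm (by simp [Fin.le_def])
      omega
    · omega
  -- The drop between consecutive sorted letters, less the drop forced by a descent; `hle` makes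
  -- both truncated subtractions exact. After the last letter, `next` is `0`.
  refine ⟨fun i => g (σ i) - desc σ i - next i, ?_⟩
  have key : ∀ d, ∀ i : Fin n, n = i + 1 + d →
      partialSums σ (fun i => g (σ i) - desc σ i - next i) i = g (σ i) := by
    intro d
    induction d with
    | zero =>
      intro i hi
      rw [partialSums_eq, dif_neg (by omega)]
      have h1 : next i = 0 := dif_neg (by omega)
      have := hle i
      omega
    | succ d ih =>
      intro i hi
      have h1 : next i = g (σ ⟨(i : ℕ) + 1, by omega⟩) := dif_pos (by omega)
      rw [partialSums_eq, dif_pos (by omega), ih _ (by simp only; omega)]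
      have := hle i
      omega
  funext i
  exact key (n - i - 1) i (by omega)

theorem one_sub_q_pow_mul_mk_dvd (d : ℕ) :
    (1 - q ^ (d + 1)) * (PowerSeries.mk fun k => if d + 1 ∣ k then 1 else 0 : R) = 1 := by
  ext1 m
  rw [sub_mul, one_mul, map_sub, q, PowerSeries.coeff_X_pow_mul', PowerSeries.coeff_mk,
    PowerSeries.coeff_one]
  by_cases hm : d + 1 ≤ m
  · have hd : d + 1 ∣ m - (d + 1) ↔ d + 1 ∣ m := by
      rw [Nat.dvd_sub_self_right, or_iff_left_of_imp]
      intro h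
      rw [le_antisymm h hm]
    rw [if_pos hm, PowerSeries.coeff_mk, if_neg (by omega : m ≠ 0)]
    simp only [hd, sub_self]
  · rw [if_neg hm, sub_zero]
    congr 1
    rw [Nat.dvd_iff_mod_eq_zero, Nat.mod_eq_of_lt (by omega)]

theorem qFactInv_eq_prod (n : ℕ) :
    qFactInv n = ∏ i : Fin n, (PowerSeries.mk fun k => if (i : ℕ) + 1 ∣ k then 1 else 0 : R) := by
  induction n with
  | zero => simp [qFactInv_zero]
  | succ n ih =>
    rw [Fin.prod_univ_castSucc]
    simp only [Fin.val_castSucc, Fin.val_last]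
    rw [← ih]
    apply mul_left_cancel₀ (one_sub_q_pow_ne_zero n)
    rw [one_sub_q_pow_mul_qFactInv]
    linear_combination -qFactInv n * one_sub_q_pow_mul_mk_dvd n

/-- Such words are parametrized freely by the differences `a i`, each of weight `q^((i+1) a i)`,
with an overall factor `q^(maj σ)`. In the expansion of `1/(q; q)_n`, the exponent `l i` taken from
the factor `1/(1 - q^(i+1))` is `(i+1) a i`. -/
theorem card_sort_eq {n : ℕ} (σ : Equiv.Perm (Fin n)) (m : ℕ) :
    (#{g ∈ Finset.Nat.antidiagonalTuple n m | Tuple.sort (OrderDual.toDual ∘ g) = σ} : K) =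
      PowerSeries.coeff m (q ^ maj σ * qFactInv n) := by
  rw [q, PowerSeries.coeff_X_pow_mul']
  split_ifs with hm
  · rw [qFactInv_eq_prod, coeff_prod_fin]
    simp only [PowerSeries.coeff_mk, prod_boole, mem_univ, true_imp_iff, sum_boole]
    congr 1
    symm
    refine Finset.card_bij
      (fun l _ => partialSums σ (fun i => l i / ((i : ℕ) + 1)) ∘ σ.symm) ?_ ?_ ?_
    · intro l hl
      rw [mem_filter, Finset.Nat.mem_antidiagonalTuple] at hl
      rw [mem_filter, Finset.Nat.mem_antidiagonalTuple]
      refine ⟨?_, sort_partialSums _ _⟩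
      have h1 : ∑ i, (partialSums σ (fun i => l i / ((i : ℕ) + 1)) ∘ σ.symm) i =
          ∑ i, partialSums σ (fun i => l i / ((i : ℕ) + 1)) i :=
        Equiv.sum_comp σ.symm (partialSums σ fun i => l i / ((i : ℕ) + 1))
      rw [h1, sum_partialSums, sum_congr rfl fun i _ => Nat.mul_div_cancel' (hl.2 i), hl.1]
      omega
    · intro l hl l' hl' h
      rw [mem_filter] at hl hl'
      have h' := partialSums_injective σ (σ.symm.surjective.injective_comp_right h)
      funext i
      rw [← Nat.mul_div_cancel' (hl.2 i), ← Nat.mul_div_cancel' (hl'.2 i), congrFun h' i]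
    · intro g hg
      rw [mem_filter, Finset.Nat.mem_antidiagonalTuple] at hg
      obtain ⟨a, ha⟩ := exists_partialSums_eq hg.2
      have hdiv : (fun i : Fin n => ((i : ℕ) + 1) * a i / ((i : ℕ) + 1)) = a := by
        funext i
        exact Nat.mul_div_cancel_left _ (Nat.succ_pos _)
      refine ⟨fun i => ((i : ℕ) + 1) * a i, ?_, ?_⟩
      · rw [mem_filter, Finset.Nat.mem_antidiagonalTuple]
        refine ⟨?_, fun i => Dvd.intro _ rfl⟩
        have h1 := sum_partialSums σ a
        have h2 : ∑ i, g (σ i) = ∑ i, g i := Equiv.sum_comp σ g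
        rw [ha] at h1
        simp only [Function.comp_apply] at h1
        omega
      · rw [hdiv, ha]
        funext i
        simp
  · rw [Nat.cast_eq_zero, Finset.card_eq_zero, Finset.filter_eq_empty_iff]
    intro g hg hσ
    rw [Finset.Nat.mem_antidiagonalTuple] at hg
    obtain ⟨a, ha⟩ := exists_partialSums_eq hσ
    have h1 := sum_partialSums σ a
    have h2 : ∑ i, g (σ i) = ∑ i, g i := Equiv.sum_comp σ g
    rw [ha] at h1
    simp only [Function.comp_apply] at h1
    omega

theorem freeSeries_univ (n : ℕ) :
    freeSeries Set.univ n = derangementPoly n q * qFactInv n := by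
  classical
  ext1 m
  rw [derangementPoly, sum_mul, map_sum, freeSeries, PowerSeries.coeff_mk]
  have h : ((words n m).filter fun x => ∀ c ∈ Set.univ, ¬ FixedAt c x).card =
      #{g ∈ Finset.Nat.antidiagonalTuple n m |
        Tuple.sort (OrderDual.toDual ∘ g) ∈ derangements (Fin n)} := by
    rw [words, filter_map, card_map]
    congr 1
    refine filter_congr fun g _ => ?_
    rw [← forall_not_fixedAt_iff g rfl]
    simp
  rw [h, Finset.card_eq_sum_card_fiberwise (f := fun g => Tuple.sort (OrderDual.toDual ∘ g))
    (t := (derangements (Fin n)).toFinset) (by intro g hg; simpa using (mem_filter.1 hg).2),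
    Nat.cast_sum]
  rw [← Finset.sum_coe_sort]
  refine Fintype.sum_equiv (Equiv.subtypeEquivRight fun σ => by simp) _ _ fun σ => ?_
  rw [← card_sort_eq]
  congr 2
  ext g
  simp only [mem_filter, Equiv.subtypeEquivRight_apply_coe]
  refine ⟨fun h => ⟨h.1.1, h.2⟩, fun h => ⟨⟨h.1, ?_⟩, h.2⟩⟩
  rw [h.2]
  exact Set.mem_toFinset.1 σ.2

/-! ### The generating series of the derangement polynomials -/

theorem mk_derangementPoly_mul_qFactInv :
    PowerSeries.mk (fun n => derangementPoly n q * qFactInv n) =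
      uPochInf * PowerSeries.mk fun n => ((1 - q)⁻¹ : R) ^ n := by
  have h := mk_freeSeries_univ
  rwa [funext freeSeries_univ, funext freeSeries_empty] at h

/-- Euler's expansion clears `(u; q)_∞` from the generating series. The resulting recurrence
determines the `D_n(q)`. -/
theorem sum_antidiagonal_derangementPoly (n : ℕ) :
    ∑ p ∈ antidiagonal n, derangementPoly p.2 q * (qFactInv p.1 * qFactInv p.2) =
      ((1 - q)⁻¹ : R) ^ n := by
  have h : PowerSeries.mk qFactInv *
      PowerSeries.mk (fun n => derangementPoly n q * qFactInv n) =
      PowerSeries.mk fun n => ((1 - q)⁻¹ : R) ^ n := by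
    rw [mk_derangementPoly_mul_qFactInv, ← mul_assoc, mul_comm _ uPochInf,
      uPochInf_mul_mk_qFactInv, one_mul]
  have h' := congrArg (PowerSeries.coeff n) h
  rw [PowerSeries.coeff_mul, PowerSeries.coeff_mk] at h'
  rw [← h']
  refine sum_congr rfl fun p _ => ?_
  simp only [PowerSeries.coeff_mk]
  ring

/-! ### Desarrangements and the pixed factorization -/

/-- The length of the longest decreasing left factor of a word. -/
def decRun : List ℤ → ℕ
  | [] => 0
  | [_] => 1
  | a :: b :: l => if b < a then decRun (b :: l) + 1 else 1

theorem decRun_spec (a : ℤ) (l : List ℤ) :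
    1 ≤ decRun (a :: l) ∧ decRun (a :: l) ≤ (a :: l).length ∧
      (∀ i, i + 1 < decRun (a :: l) → (a :: l).getD i 0 > (a :: l).getD (i + 1) 0) ∧
      (decRun (a :: l) < (a :: l).length →
        (a :: l).getD (decRun (a :: l) - 1) 0 ≤ (a :: l).getD (decRun (a :: l)) 0) := by
  induction l generalizing a with
  | nil => simp [decRun]
  | cons b l ih =>
    rw [decRun]
    split_ifs with hab
    · obtain ⟨h1, h2, h3, h4⟩ := ih b
      refine ⟨by omega, by simpa using h2, fun i hi => ?_, fun h => ?_⟩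
      · cases i with
        | zero => simpa using hab
        | succ i =>
          rw [List.getD_cons_succ, List.getD_cons_succ]
          exact h3 i (by omega)
      · have h5 := h4 (by simpa using h)
        obtain ⟨r, hr⟩ : ∃ r, decRun (b :: l) = r + 1 := ⟨_, (Nat.sub_add_cancel h1).symm⟩
        rw [hr] at h5 ⊢
        simpa only [Nat.add_sub_cancel, List.getD_cons_succ] using h5
    · refine ⟨le_rfl, by simp, fun i hi => by omega, fun _ => ?_⟩
      simpa using hab

theorem isDesarrangement_iff_even_decRun {l : List ℤ} (hl : l.Nodup) :
    IsDesarrangement l ↔ Even (decRun l) := by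
  cases l with
  | nil => simp [IsDesarrangement, decRun]
  | cons a l =>
    obtain ⟨h1, h2, h3, h4⟩ := decRun_spec a l
    constructor
    · rintro (h | ⟨k, hk1, hk2, hk3, hk4⟩)
      · simp at h
      · rw [even_iff_two_dvd]
        refine ⟨k, ?_⟩
        rcases lt_trichotomy (decRun (a :: l)) (2 * k) with h | h | h
        · have h5 := hk3 (decRun (a :: l) - 1) (by omega)
          rw [Nat.sub_add_cancel h1] at h5
          exact absurd (h4 (by omega)) h5.not_ge
        · exact h
        · have h5 := h3 (2 * k - 1) (by omega)
          rw [Nat.sub_add_cancel (by omega)] at h5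
          exact absurd (hk4 (by omega)) h5.not_gt
    · rintro h
      obtain ⟨k, hk⟩ := even_iff_two_dvd.1 h
      refine Or.inr ⟨k, by omega, by omega, fun i hi => h3 i (by omega), fun hlt => ?_⟩
      rw [hk] at h4
      refine lt_of_le_of_ne (h4 hlt) fun heq => ?_
      rw [List.getD_eq_getElem _ _ hlt, List.getD_eq_getElem _ _ (by omega),
        hl.getElem_inj_iff] at heq
      omega

theorem isDesarrangement_nil : IsDesarrangement [] := Or.inl rfl

theorem not_isDesarrangement_singleton (a : ℤ) : ¬ IsDesarrangement [a] := by
  rw [isDesarrangement_iff_even_decRun (List.nodup_singleton a)]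
  simp [decRun]

/-- A new first letter either extends the initial decreasing run by one, reversing the parity, or
starts a run of length one, which is odd. -/
theorem isDesarrangement_cons_cons {a b : ℤ} {l : List ℤ} (hl : (a :: b :: l).Nodup) :
    IsDesarrangement (a :: b :: l) ↔ b < a ∧ ¬ IsDesarrangement (b :: l) := by
  rw [isDesarrangement_iff_even_decRun hl, isDesarrangement_iff_even_decRun hl.of_cons, decRun]
  split_ifs with h
  · simp [h, Nat.even_add_one]
  · simp [h]

theorem pixPrefix_eq_nil {l : List ℤ} (hl : IsDesarrangement l) : pixPrefix l = [] := by
  cases l with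
  | nil => rfl
  | cons a l => rw [pixPrefix, if_pos hl]

/-- The pixed factorization: every word is an increasing word followed by a desarrangement. -/
theorem pixPrefix_spec {l : List ℤ} (hl : l.Nodup) :
    (pixPrefix l).IsChain (· < ·) ∧ ∃ d, IsDesarrangement d ∧ l = pixPrefix l ++ d := by
  induction l with
  | nil => exact ⟨List.IsChain.nil, [], isDesarrangement_nil, rfl⟩
  | cons a l ih =>
    obtain ⟨hc, d, hd, hld⟩ := ih hl.of_cons
    by_cases h : IsDesarrangement (a :: l)
    · rw [pixPrefix_eq_nil h]
      exact ⟨List.IsChain.nil, _, h, rfl⟩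
    · rw [pixPrefix, if_neg h]
      refine ⟨?_, d, hd, by rw [List.cons_append, ← hld]⟩
      generalize hp : pixPrefix l = p at *
      cases p with
      | nil => exact List.IsChain.singleton a
      | cons b p =>
        rw [List.isChain_cons_cons]
        refine ⟨?_, hc⟩
        rw [List.cons_append] at hld
        subst hld
        have hb : ¬ IsDesarrangement (b :: (p ++ d)) := fun hb => by
          rw [pixPrefix_eq_nil hb] at hp
          exact List.cons_ne_nil _ _ hp.symm
        rw [isDesarrangement_cons_cons hl] at h
        have hne : a ≠ b := fun hab => by simp [hab] at hl
        rcases lt_or_gt_of_ne hne with h' | h'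
        · exact h'
        · exact absurd ⟨h', hb⟩ h

/-- Uniqueness of the factorization: a right factor starting inside `v` begins with an ascent, is a
single letter, or is a desarrangement preceded by one letter; none of these is a desarrangement. -/
theorem pixPrefix_append {v d : List ℤ} (hv : v.IsChain (· < ·)) (hd : IsDesarrangement d)
    (hl : (v ++ d).Nodup) : pixPrefix (v ++ d) = v := by
  induction v with
  | nil => exact pixPrefix_eq_nil hd
  | cons a v ih =>
    rw [List.cons_append] at hl ⊢
    have ha : ¬ IsDesarrangement (a :: (v ++ d)) := by
      cases v with
      | nil =>
        cases d with
        | nil => exact not_isDesarrangement_singleton a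
        | cons b d =>
          rw [List.nil_append] at hl ⊢
          rw [isDesarrangement_cons_cons hl]
          exact fun h => h.2 hd
      | cons b v =>
        rw [List.cons_append] at hl ⊢
        rw [isDesarrangement_cons_cons hl]
        exact fun h => h.1.not_gt (List.isChain_cons_cons.1 hv).1
    rw [pixPrefix, if_neg ha, ih hv.tail hl.of_cons]

/-! ### Inversions of words with a given set of letters -/

/-- The number of inversions of a word, given as a list. -/
def linv : List ℤ → ℕ
  | [] => 0
  | a :: l => l.countP (· < a) + linv l

theorem inv_eq_linv {n : ℕ} (x : Fin n → ℤ) : inv x = linv (List.ofFn x) := by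
  have hinv : ∀ {n : ℕ} (x : Fin n → ℤ), inv x = ∑ i, #{j | i < j ∧ x j < x i} := by
    intro n x
    simp only [inv, card_filter]
    rw [← univ_product_univ, sum_product]
  induction n with
  | zero => simp [inv, linv]
  | succ n ih =>
    rw [List.ofFn_succ, linv, ← ih fun i => x i.succ, hinv, hinv, Fin.sum_univ_succ,
      countP_ofFn (fun i : Fin n => x i.succ) (· < x 0)]
    simp only [card_filter, Fin.sum_univ_succ]
    simp

theorem linv_append (l l' : List ℤ) :
    linv (l ++ l') = linv l + linv l' + (l.map fun a => l'.countP (· < a)).sum := by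
  induction l with
  | nil => simp [linv]
  | cons a l ih =>
    simp only [List.cons_append, linv, List.countP_append, List.map_cons, List.sum_cons, ih]
    omega

theorem linv_eq_zero {l : List ℤ} (hl : l.Pairwise (· ≤ ·)) : linv l = 0 := by
  induction l with
  | nil => rfl
  | cons a l ih =>
    rw [List.pairwise_cons] at hl
    rw [linv, ih hl.2, add_zero, List.countP_eq_zero]
    intro b hb
    simpa using hl.1 b hb

/-- The words whose letters are the elements of `T`, each occurring once. -/
def arrangements (T : Finset ℤ) : Finset (List ℤ) := ⟨T.val.lists, Multiset.lists_nodup_finset T⟩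

theorem mem_arrangements {T : Finset ℤ} {l : List ℤ} :
    l ∈ arrangements T ↔ l.Nodup ∧ l.toFinset = T := by
  have h : l ∈ arrangements T ↔ T.val = (l : Multiset ℤ) := Multiset.mem_lists_iff _ _
  rw [h]
  constructor
  · intro h
    have hl : l.Nodup := by
      rw [← Multiset.coe_nodup, ← h]
      exact T.nodup
    refine ⟨hl, ?_⟩
    rw [← List.toFinset_eq hl]
    exact Finset.eq_of_veq h.symm
  · rintro ⟨hl, rfl⟩
    rw [← List.toFinset_eq hl]

theorem countP_eq_card_filter {l : List ℤ} (hl : l.Nodup) (p : ℤ → Prop) [DecidablePred p] :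
    l.countP (p ·) = #{t ∈ l.toFinset | p t} := by
  rw [List.countP_eq_length_filter, ← List.toFinset_card_of_nodup (hl.filter _),
    List.toFinset_filter]
  simp

/-- The number of pairs consisting of a letter in `V` and a smaller letter in `D`. -/
def crossInv (V D : Finset ℤ) : ℕ := ∑ v ∈ V, #{d ∈ D | d < v}

theorem linv_sort_append {V D : Finset ℤ} {d : List ℤ} (hd : d ∈ arrangements D) :
    linv (V.sort ++ d) = linv d + crossInv V D := by
  rw [mem_arrangements] at hd
  rw [linv_append, linv_eq_zero (pairwise_sort V (· ≤ ·)), zero_add, crossInv]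
  congr 1
  have h : ∀ a, d.countP (· < a) = #{t ∈ D | t < a} := by
    intro a
    rw [countP_eq_card_filter hd.1, hd.2]
  simp only [h]
  rw [← List.sum_toFinset _ (sort_nodup V (· ≤ ·)), sort_toFinset]

open Classical in
/-- The desarrangements whose letters are the elements of `T`, each occurring once. -/
def desarrangements (T : Finset ℤ) : Finset (List ℤ) := {l ∈ arrangements T | IsDesarrangement l}

theorem mem_desarrangements {T : Finset ℤ} {l : List ℤ} :
    l ∈ desarrangements T ↔ l ∈ arrangements T ∧ IsDesarrangement l := by
  classical
  exact mem_filter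

theorem isChain_sort (V : Finset ℤ) : V.sort.IsChain (· < ·) :=
  List.isChain_iff_pairwise.2 (sortedLT_sort V).pairwise

theorem sort_append_mem_arrangements {T V : Finset ℤ} (hV : V ⊆ T) {d : List ℤ}
    (hd : d ∈ arrangements (T \ V)) : V.sort ++ d ∈ arrangements T := by
  rw [mem_arrangements] at hd ⊢
  refine ⟨List.nodup_append'.2 ⟨sort_nodup _ _, hd.1, fun a ha ha' => ?_⟩, ?_⟩
  · rw [← List.mem_toFinset, hd.2, mem_sdiff] at ha'
    exact ha'.2 ((mem_sort _).1 ha)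
  · rw [List.toFinset_append, hd.2, sort_toFinset, union_sdiff_of_subset hV]

theorem pixPrefix_sort_append {T V : Finset ℤ} (hV : V ⊆ T) {d : List ℤ}
    (hd : d ∈ desarrangements (T \ V)) : pixPrefix (V.sort ++ d) = V.sort := by
  rw [mem_desarrangements] at hd
  exact pixPrefix_append (isChain_sort V) hd.2
    (mem_arrangements.1 (sort_append_mem_arrangements hV hd.1)).1

/-- The pixed factorization as a bijection. -/
theorem sum_arrangements_eq {M : Type*} [AddCommMonoid M] (T : Finset ℤ) (f : List ℤ → M) :
    ∑ l ∈ arrangements T, f l =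
      ∑ V ∈ T.powerset, ∑ d ∈ desarrangements (T \ V), f (V.sort ++ d) := by
  rw [sum_sigma']
  symm
  refine Finset.sum_bij (fun s _ => s.1.sort ++ s.2) ?_ ?_ ?_ fun _ _ => rfl
  · rintro ⟨V, d⟩ h
    rw [mem_sigma, mem_powerset, mem_desarrangements] at h
    exact sort_append_mem_arrangements h.1 h.2.1
  · rintro ⟨V, d⟩ h ⟨V', d'⟩ h' heq
    rw [mem_sigma, mem_powerset] at h h'
    have h1 := pixPrefix_sort_append h.1 h.2
    dsimp only at heq h1
    rw [heq, pixPrefix_sort_append h'.1 h'.2] at h1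
    obtain rfl : V = V' := by
      rw [← sort_toFinset V (· ≤ ·), ← h1, sort_toFinset]
    rw [List.append_cancel_left heq]
  · intro l hl
    rw [mem_arrangements] at hl
    obtain ⟨hc, d, hd, hld⟩ := pixPrefix_spec hl.1
    have hnd := hl.1
    rw [hld, List.nodup_append'] at hnd
    have hsort : (pixPrefix l).toFinset.sort = pixPrefix l :=
      (List.toFinset_sort (· ≤ ·) hnd.1).2
        ((List.isChain_iff_pairwise.1 hc).imp fun h => le_of_lt h)
    refine ⟨⟨(pixPrefix l).toFinset, d⟩, ?_, ?_⟩
    · have hT : T = (pixPrefix l).toFinset ∪ d.toFinset := by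
        rw [← hl.2, ← List.toFinset_append, ← hld]
      rw [mem_sigma, mem_powerset, mem_desarrangements, mem_arrangements]
      refine ⟨hT ▸ subset_union_left, ⟨hnd.2.1, ?_⟩, hd⟩
      dsimp only
      rw [hT, union_sdiff_cancel_left]
      rw [Finset.disjoint_left]
      intro a ha ha'
      rw [List.mem_toFinset] at ha ha'
      exact hnd.2.2 ha ha'
    · dsimp only
      rw [hsort, ← hld]

/-! ### Equidistribution of desarrangements and derangements -/

theorem sum_arrangements_eq_sum_cons {M : Type*} [AddCommMonoid M] {T : Finset ℤ}
    (hT : T.Nonempty) (f : List ℤ → M) :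
    ∑ l ∈ arrangements T, f l = ∑ a ∈ T, ∑ l ∈ arrangements (T.erase a), f (a :: l) := by
  rw [sum_sigma']
  symm
  refine Finset.sum_bij (fun s _ => s.1 :: s.2) ?_ ?_ ?_ fun _ _ => rfl
  · rintro ⟨a, l⟩ h
    rw [mem_sigma, mem_arrangements] at h
    obtain ⟨ha, hl, hlT⟩ := h
    dsimp only at *
    rw [mem_arrangements, List.nodup_cons, List.toFinset_cons, hlT, insert_erase ha]
    refine ⟨⟨?_, hl⟩, rfl⟩
    rw [← List.mem_toFinset, hlT]
    exact notMem_erase _ _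
  · rintro ⟨a, l⟩ _ ⟨b, l'⟩ _ h
    obtain ⟨rfl, rfl⟩ := List.cons.inj h
    rfl
  · rintro l hl
    rw [mem_arrangements] at hl
    obtain ⟨hl, rfl⟩ := hl
    cases l with
    | nil => simp at hT
    | cons a l =>
      rw [List.nodup_cons] at hl
      refine ⟨⟨a, l⟩, ?_, rfl⟩
      rw [mem_sigma, mem_arrangements]
      refine ⟨by simp, hl.2, ?_⟩
      rw [List.toFinset_cons, erase_insert]
      rw [List.mem_toFinset]
      exact hl.1

theorem sum_pow_card_lt {A : Type*} [CommRing A] (q : A) (T : Finset ℤ) :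
    ∑ a ∈ T, q ^ #{t ∈ T | t < a} = ∑ i ∈ range #T, q ^ i := by
  induction T using Finset.induction_on_max with
  | empty => simp
  | insert x T hx ih =>
    have hxT : x ∉ T := fun h => lt_irrefl x (hx x h)
    rw [sum_insert hxT, card_insert_of_notMem hxT, sum_range_succ, ← ih, add_comm]
    congr 1
    · refine sum_congr rfl fun a ha => ?_
      rw [filter_insert, if_neg (hx a ha).not_gt]
    · rw [filter_insert, if_neg (lt_irrefl x), filter_true_of_mem hx]

theorem one_sub_q_mul_inv : (1 - q : R) * (1 - q)⁻¹ = 1 :=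
  PowerSeries.mul_inv_cancel _ (by simp [constantCoeff_q])

/-- The generating polynomial of the permutations by the number of inversions. -/
theorem sum_arrangements_pow_linv (T : Finset ℤ) :
    ∑ l ∈ arrangements T, q ^ linv l = qPoch q q #T * ((1 - q)⁻¹ : R) ^ #T := by
  generalize hn : #T = n
  induction n generalizing T with
  | zero =>
    rw [card_eq_zero] at hn
    subst hn
    have h : arrangements ∅ = {[]} := by
      ext l
      simp only [mem_arrangements, List.toFinset_eq_empty_iff, mem_singleton]
      exact ⟨fun h => h.2, fun h => ⟨h ▸ List.nodup_nil, h⟩⟩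
    simp [h, linv, qPoch_zero]
  | succ n ih =>
    have hT : T.Nonempty := by
      rw [← card_pos]
      omega
    rw [sum_arrangements_eq_sum_cons hT]
    have h1 : ∀ a ∈ T, ∑ l ∈ arrangements (T.erase a), q ^ linv (a :: l) =
        q ^ #{t ∈ T | t < a} * (qPoch q q n * ((1 - q)⁻¹ : R) ^ n) := by
      intro a ha
      rw [← ih (T.erase a) (by rw [card_erase_of_mem ha, hn, Nat.add_sub_cancel]), mul_sum]
      refine sum_congr rfl fun l hl => ?_
      rw [mem_arrangements] at hl
      rw [linv, pow_add, countP_eq_card_filter hl.1, hl.2, filter_erase, erase_eq_of_notMem]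
      simp
    rw [sum_congr rfl h1, ← sum_mul, sum_pow_card_lt, hn, qPoch_succ, pow_succ (1 - q)⁻¹ n,
      ← pow_succ', ← mul_neg_geom_sum]
    linear_combination (∑ i ∈ range (n + 1), q ^ i) * qPoch q q n * ((1 - q)⁻¹ : R) ^ n *
      (-one_sub_q_mul_inv)

theorem crossInv_insert_left {x : ℤ} {V D : Finset ℤ} (hx : x ∉ V) :
    crossInv (insert x V) D = #{d ∈ D | d < x} + crossInv V D := sum_insert hx

theorem crossInv_insert_right {x : ℤ} {V D : Finset ℤ} (hx : x ∉ D) :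
    crossInv V (insert x D) = #{v ∈ V | x < v} + crossInv V D := by
  rw [crossInv, crossInv, card_filter, ← sum_add_distrib]
  refine sum_congr rfl fun v _ => ?_
  rw [filter_insert]
  split_ifs with h
  · rw [card_insert_of_notMem (fun h' => hx (mem_filter.1 h').1), add_comm]
  · rw [zero_add]

/-- Sums over the pairs of a subset of `insert x T` and its complement. -/
theorem sum_powerset_insert_sdiff {M : Type*} [AddCommMonoid M] {x : ℤ} {T : Finset ℤ}
    (hx : x ∉ T) (f : Finset ℤ → Finset ℤ → M) :
    ∑ V ∈ (insert x T).powerset, f V (insert x T \ V) =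
      ∑ V ∈ T.powerset, (f (insert x V) (T \ V) + f V (insert x (T \ V))) := by
  rw [sum_powerset_insert hx, add_comm, ← sum_add_distrib]
  refine sum_congr rfl fun V hV => ?_
  rw [mem_powerset] at hV
  rw [insert_sdiff_of_notMem _ fun h => hx (hV h), insert_sdiff_insert, sdiff_insert_of_notMem hx]

/-- The `q`-binomial coefficients as generating polynomials of subsets. -/
theorem sum_powerset_pow_crossInv (T : Finset ℤ) (g : ℕ → ℕ → R) :
    ∑ V ∈ T.powerset, q ^ crossInv V (T \ V) * g #V #(T \ V) =
      qPoch q q #T * ∑ p ∈ antidiagonal #T, g p.1 p.2 * (qFactInv p.1 * qFactInv p.2) := by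
  induction T using Finset.induction_on_max generalizing g with
  | empty => simp [crossInv, qPoch_zero, qFactInv_zero]
  | insert x T hx ih =>
    have hxT : x ∉ T := fun h => lt_irrefl x (hx x h)
    rw [sum_powerset_insert_sdiff hxT fun V D => q ^ crossInv V D * g #V #D,
      card_insert_of_notMem hxT]
    -- The maximum `x` is inverted with every element of the complement if it joins `V`, and with
    -- nothing otherwise. The weight `g` changes accordingly, which is why it is generalized in the
    -- induction.
    have h1 : ∀ V ∈ T.powerset, q ^ crossInv (insert x V) (T \ V) * g #(insert x V) #(T \ V) +
        q ^ crossInv V (insert x (T \ V)) * g #V #(insert x (T \ V)) =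
        q ^ crossInv V (T \ V) * (fun i j => q ^ j * g (i + 1) j + g i (j + 1)) #V #(T \ V) := by
      intro V hV
      rw [mem_powerset] at hV
      have hxV : x ∉ V := fun h => hxT (hV h)
      have hxD : x ∉ T \ V := fun h => hxT (mem_sdiff.1 h).1
      rw [crossInv_insert_left hxV, crossInv_insert_right hxD, card_insert_of_notMem hxV,
        card_insert_of_notMem hxD, filter_true_of_mem fun d hd => hx d (mem_sdiff.1 hd).1,
        filter_false_of_mem fun v hv => (hx v (hV hv)).not_gt, card_empty]
      ring
    rw [sum_congr rfl h1, ih fun i j => q ^ j * g (i + 1) j + g i (j + 1), qPoch_succ, ← pow_succ',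
      mul_assoc]
    congr 1
    generalize #T = n
    have hsplit : (1 - q ^ (n + 1)) * ∑ p ∈ antidiagonal (n + 1),
        g p.1 p.2 * (qFactInv p.1 * qFactInv p.2) =
        ∑ p ∈ antidiagonal (n + 1), q ^ p.2 * g p.1 p.2 *
          (((1 - q ^ p.1) * qFactInv p.1) * qFactInv p.2) +
        ∑ p ∈ antidiagonal (n + 1), g p.1 p.2 *
          (qFactInv p.1 * ((1 - q ^ p.2) * qFactInv p.2)) := by
      rw [mul_sum, ← sum_add_distrib]
      refine sum_congr rfl fun p hp => ?_
      rw [← mem_antidiagonal.1 hp, pow_add]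
      ring
    rw [hsplit, Finset.Nat.sum_antidiagonal_succ, Finset.Nat.sum_antidiagonal_succ']
    simp only [one_sub_q_pow_mul_qFactInv, pow_zero, sub_self, zero_mul, mul_zero, zero_add,
      ← sum_add_distrib]
    exact sum_congr rfl fun p _ => by ring

/-- Desarrangements by inversions and derangements by the major index are equidistributed. -/
theorem sum_desarrangements_pow_linv (T : Finset ℤ) :
    ∑ d ∈ desarrangements T, q ^ linv d = (derangementPoly #T q : R) := by
  induction T using Finset.strongInduction with
  | H T ih =>
    have h1 : ∑ V ∈ T.powerset, q ^ crossInv V (T \ V) *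
        ∑ d ∈ desarrangements (T \ V), q ^ linv d = qPoch q q #T * ((1 - q)⁻¹ : R) ^ #T := by
      rw [← sum_arrangements_pow_linv, sum_arrangements_eq]
      refine sum_congr rfl fun V _ => ?_
      rw [mul_sum]
      refine sum_congr rfl fun d hd => ?_
      rw [linv_sort_append (mem_desarrangements.1 hd).1, pow_add, mul_comm]
    have h2 := sum_powerset_pow_crossInv T fun _ j => derangementPoly j q
    -- Both families satisfy the same recurrence; the term `V = ∅` is the one for `T` itself, and
    -- the others concern proper subsets.
    rw [sum_antidiagonal_derangementPoly, ← h1, ← add_sum_erase _ _ (empty_mem_powerset T),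
      ← add_sum_erase _ _ (empty_mem_powerset T)] at h2
    have h3 : ∑ V ∈ T.powerset.erase ∅, q ^ crossInv V (T \ V) * derangementPoly #(T \ V) q =
        ∑ V ∈ T.powerset.erase ∅, q ^ crossInv V (T \ V) *
          ∑ d ∈ desarrangements (T \ V), q ^ linv d := by
      refine sum_congr rfl fun V hV => ?_
      rw [mem_erase, mem_powerset, ← nonempty_iff_ne_empty] at hV
      rw [ih _ (sdiff_ssubset hV.2 hV.1)]
    rw [h3] at h2
    have h4 := add_right_cancel h2
    rw [sdiff_empty] at h4
    simpa [crossInv] using h4.symm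

/-! ### Splitting signed sets -/

/-- The sum of the absolute values of the negative elements. -/
def negSum (T : Finset ℤ) : ℕ := ∑ t ∈ T, if t < 0 then t.natAbs else 0

/-- The numbers of positive and of negative elements of `V`, and of negative and of positive
elements of `D`. -/
def signCounts (V D : Finset ℤ) : Fin 4 → ℕ :=
  ![#{t ∈ V | 0 < t}, #{t ∈ V | t < 0}, #{t ∈ D | t < 0}, #{t ∈ D | 0 < t}]

theorem signCounts_insert_left_pos {x : ℤ} {V D : Finset ℤ} (hx : x ∉ V) (h : 0 < x) :
    signCounts (insert x V) D = signCounts V D + Pi.single 0 1 := by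
  ext i
  fin_cases i <;> simp [signCounts, filter_insert, h, h.not_gt, hx]

theorem signCounts_insert_left_neg {x : ℤ} {V D : Finset ℤ} (hx : x ∉ V) (h : x < 0) :
    signCounts (insert x V) D = signCounts V D + Pi.single 1 1 := by
  ext i
  fin_cases i <;> simp [signCounts, filter_insert, h, h.not_gt, hx]

theorem signCounts_insert_right_neg {x : ℤ} {V D : Finset ℤ} (hx : x ∉ D) (h : x < 0) :
    signCounts V (insert x D) = signCounts V D + Pi.single 2 1 := by
  ext i
  fin_cases i <;> simp [signCounts, filter_insert, h, h.not_gt, hx]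

theorem signCounts_insert_right_pos {x : ℤ} {V D : Finset ℤ} (hx : x ∉ D) (h : 0 < x) :
    signCounts V (insert x D) = signCounts V D + Pi.single 3 1 := by
  ext i
  fin_cases i <;> simp [signCounts, filter_insert, h, h.not_gt, hx]

theorem card_eq_add_of_zero_notMem {T : Finset ℤ} (h : (0 : ℤ) ∉ T) :
    #T = #{t ∈ T | t < 0} + #{t ∈ T | 0 < t} := by
  rw [← Finset.card_filter_add_card_filter_not (s := T) (fun t => t < 0)]
  congr 2
  refine filter_congr fun t ht => ?_
  have : t ≠ 0 := fun h0 => h (h0 ▸ ht)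
  omega

/-- The generating function of the pairs of a subset of `T` and its complement. -/
def splitSum (T : Finset ℤ) (f : (Fin 4 → ℕ) → R) : R :=
  ∑ V ∈ T.powerset, q ^ (negSum T + crossInv V (T \ V)) * f (signCounts V (T \ V))

/-- A new maximum creates inversions only when it joins `V`: one with each of the `c 2 + c 3`
letters of the complement. -/
theorem splitSum_insert_pos {T : Finset ℤ} (h0 : (0 : ℤ) ∉ T) {x : ℤ} (h : 0 < x)
    (hx : ∀ t ∈ T, t < x) (f : (Fin 4 → ℕ) → R) :
    splitSum (insert x T) f = splitSum T fun c =>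
      q ^ (c 2 + c 3) * f (c + Pi.single 0 1) + f (c + Pi.single 3 1) := by
  have hxT : x ∉ T := fun h => lt_irrefl x (hx x h)
  have hneg : negSum (insert x T) = negSum T := by
    rw [negSum, sum_insert hxT, if_neg h.not_gt, zero_add]
    rfl
  rw [splitSum, hneg, sum_powerset_insert_sdiff hxT
    fun V D => q ^ (negSum T + crossInv V D) * f (signCounts V D), splitSum]
  refine sum_congr rfl fun V hV => ?_
  rw [mem_powerset] at hV
  have hxV : x ∉ V := fun h => hxT (hV h)
  have hxD : x ∉ T \ V := fun h => hxT (mem_sdiff.1 h).1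
  rw [crossInv_insert_left hxV, crossInv_insert_right hxD, signCounts_insert_left_pos hxV h,
    signCounts_insert_right_pos hxD h, filter_true_of_mem fun d hd => hx d (mem_sdiff.1 hd).1,
    filter_false_of_mem fun v hv => (hx v (hV hv)).not_gt, card_empty,
    card_eq_add_of_zero_notMem fun h => h0 (mem_sdiff.1 h).1]
  have h2 : signCounts V (T \ V) 2 = #{t ∈ T \ V | t < 0} := rfl
  have h3 : signCounts V (T \ V) 3 = #{t ∈ T \ V | 0 < t} := rfl
  rw [h2, h3]
  ring

/-- A new minimum always contributes its absolute value, and creates inversions only when it joins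
the complement: one with each of the `c 0 + c 1` letters of `V`. -/
theorem splitSum_insert_neg {T : Finset ℤ} (h0 : (0 : ℤ) ∉ T) {x : ℤ} (h : x < 0)
    (hx : ∀ t ∈ T, x < t) (f : (Fin 4 → ℕ) → R) :
    splitSum (insert x T) f = splitSum T fun c =>
      q ^ x.natAbs * f (c + Pi.single 1 1) +
        q ^ (x.natAbs + c 0 + c 1) * f (c + Pi.single 2 1) := by
  have hxT : x ∉ T := fun h => lt_irrefl x (hx x h)
  have hneg : negSum (insert x T) = x.natAbs + negSum T := by
    rw [negSum, sum_insert hxT, if_pos h]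
    rfl
  rw [splitSum, hneg, sum_powerset_insert_sdiff hxT
    fun V D => q ^ (x.natAbs + negSum T + crossInv V D) * f (signCounts V D), splitSum]
  refine sum_congr rfl fun V hV => ?_
  rw [mem_powerset] at hV
  have hxV : x ∉ V := fun h => hxT (hV h)
  have hxD : x ∉ T \ V := fun h => hxT (mem_sdiff.1 h).1
  rw [crossInv_insert_left hxV, crossInv_insert_right hxD, signCounts_insert_left_neg hxV h,
    signCounts_insert_right_neg hxD h, filter_true_of_mem fun v hv => hx v (hV hv),
    filter_false_of_mem fun d hd => (hx d (mem_sdiff.1 hd).1).not_gt, card_empty,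
    card_eq_add_of_zero_notMem fun h => h0 (hV h)]
  have h2 : signCounts V (T \ V) 0 = #{t ∈ V | 0 < t} := rfl
  have h3 : signCounts V (T \ V) 1 = #{t ∈ V | t < 0} := rfl
  rw [h2, h3]
  ring

/-- The integers `±1, …, ±n`, where `-(a + 1)` is chosen for `a ∈ N`. -/
def signedSet (n : ℕ) (N : Finset ℕ) : Finset ℤ :=
  (range n).image fun a : ℕ => if a ∈ N then -((a : ℤ) + 1) else (a : ℤ) + 1

theorem mem_signedSet {n : ℕ} {N : Finset ℕ} {t : ℤ} :
    t ∈ signedSet n N ↔ ∃ a < n, (if a ∈ N then -((a : ℤ) + 1) else (a : ℤ) + 1) = t := by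
  simp [signedSet]

theorem abs_le_of_mem_signedSet {n : ℕ} {N : Finset ℕ} {t : ℤ} (ht : t ∈ signedSet n N) :
    t ≠ 0 ∧ -(n : ℤ) ≤ t ∧ t ≤ n := by
  obtain ⟨a, ha, rfl⟩ := mem_signedSet.1 ht
  split_ifs <;> omega

theorem abs_injOn_signedSet {n : ℕ} {N : Finset ℕ} {s t : ℤ} (hs : s ∈ signedSet n N)
    (ht : t ∈ signedSet n N) (h : |s| = |t|) : s = t := by
  obtain ⟨a, ha, rfl⟩ := mem_signedSet.1 hs
  obtain ⟨b, hb, rfl⟩ := mem_signedSet.1 ht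
  have ha' : |if a ∈ N then -((a : ℤ) + 1) else (a : ℤ) + 1| = a + 1 := by
    split_ifs
    · rw [abs_neg, abs_of_nonneg (by omega)]
    · rw [abs_of_nonneg (by omega)]
  have hb' : |if b ∈ N then -((b : ℤ) + 1) else (b : ℤ) + 1| = b + 1 := by
    split_ifs
    · rw [abs_neg, abs_of_nonneg (by omega)]
    · rw [abs_of_nonneg (by omega)]
  obtain rfl : a = b := by omega
  rfl

theorem neg_mem_signedSet {n : ℕ} {N : Finset ℕ} (a : ℕ) :
    -((a : ℤ) + 1) ∈ signedSet n N ↔ a < n ∧ a ∈ N := by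
  rw [mem_signedSet]
  constructor
  · rintro ⟨b, hb, h⟩
    split_ifs at h with hN
    · obtain rfl : b = a := by omega
      exact ⟨hb, hN⟩
    · omega
  · rintro ⟨h, hN⟩
    exact ⟨a, h, if_pos hN⟩

theorem card_signedSet (n : ℕ) (N : Finset ℕ) : #(signedSet n N) = n := by
  rw [signedSet, card_image_of_injective, card_range]
  intro a b h
  dsimp only at h
  split_ifs at h <;> omega

theorem signedSet_succ_of_notMem {n : ℕ} {N : Finset ℕ} (h : n ∉ N) :
    signedSet (n + 1) N = insert ((n : ℤ) + 1) (signedSet n N) := by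
  rw [signedSet, range_add_one, image_insert, if_neg h]
  rfl

theorem signedSet_succ_insert (n : ℕ) (N : Finset ℕ) :
    signedSet (n + 1) (insert n N) = insert (-((n : ℤ) + 1)) (signedSet n N) := by
  rw [signedSet, range_add_one, image_insert, if_pos (mem_insert_self _ _), signedSet]
  congr 1
  refine image_congr fun a ha => ?_
  have : a ≠ n := (mem_range.1 ha).ne
  simp [this]

/-- The factor `1 - q^(m b)` kills the tuples with `m b = 0`; in the others the entry at `b` can be
lowered by one. -/
theorem sum_antidiagonalTuple_succ {k n : ℕ} (b : Fin k) (h : (Fin k → ℕ) → R) :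
    ∑ m ∈ Finset.Nat.antidiagonalTuple k (n + 1), (1 - q ^ m b) * h m =
      ∑ m ∈ Finset.Nat.antidiagonalTuple k n,
        (1 - q ^ (m b + 1)) * h (m + Pi.single b 1) := by
  symm
  refine Finset.sum_bij_ne_zero (fun m _ _ => m + Pi.single b 1) ?_ ?_ ?_ ?_
  · intro m hm _
    rw [Finset.Nat.mem_antidiagonalTuple] at hm ⊢
    simp [sum_add_distrib, hm]
  · intro m _ _ m' _ _ h
    exact add_right_cancel h
  · intro m hm hne
    rw [Finset.Nat.mem_antidiagonalTuple] at hm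
    have hb : m b ≠ 0 := fun hb => by simp [hb] at hne
    have hle : (Pi.single b 1 : Fin k → ℕ) ≤ m := by
      intro i
      rcases eq_or_ne i b with rfl | hi
      · rw [Pi.single_eq_same]
        exact Nat.one_le_iff_ne_zero.2 hb
      · rw [Pi.single_eq_of_ne hi]
        exact Nat.zero_le _
    have hsub : m - (Pi.single b 1 : Fin k → ℕ) + Pi.single b 1 = m := tsub_add_cancel_of_le hle
    have hval : (m - (Pi.single b 1 : Fin k → ℕ)) b + 1 = m b := by
      have := congrFun hsub b
      rwa [Pi.add_apply, Pi.single_eq_same] at this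
    refine ⟨m - Pi.single b 1, ?_, ?_, hsub⟩
    · rw [Finset.Nat.mem_antidiagonalTuple]
      have := congrArg (fun f => ∑ i, f i) hsub
      simp only [Pi.add_apply, sum_add_distrib, sum_pi_single', mem_univ, if_true, hm] at this
      simp at this
      omega
    · rw [hsub, hval]
      exact hne
  · intro m _ _
    rw [Pi.add_apply, Pi.single_eq_same]

theorem qMultinomial_four (m : Fin 4 → ℕ) :
    qMultinomial m = qPoch q q (∑ s, m s) *
      (qFactInv (m 0) * qFactInv (m 1) * qFactInv (m 2) * qFactInv (m 3)) := by
  rw [qMultinomial, Fin.prod_univ_four]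
  simp only [PowerSeries.mul_inv_rev, qFactInv]
  ring

theorem choose_two_succ (n : ℕ) : (n + 1).choose 2 = n.choose 2 + n := by
  rw [Nat.choose_succ_succ' n 1, Nat.choose_one_right, add_comm]

/-- The generating function of the ordered partitions of a signed set into its `w⁺`, `w⁻`, and
the negative and positive letters of `wᵈ`. -/
theorem sum_splitSum (n : ℕ) (f : (Fin 4 → ℕ) → R) :
    ∑ N ∈ (range n).powerset, splitSum (signedSet n N) f =
      qPoch q q n * ∑ m ∈ Finset.Nat.antidiagonalTuple 4 n,
        qFactInv (m 0) * qFactInv (m 1) * qFactInv (m 2) * qFactInv (m 3) *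
          q ^ ((m 1 + m 2 + 1).choose 2 + m 0 * m 2) * f m := by
  induction n generalizing f with
  | zero =>
    have h : signCounts ∅ ∅ = 0 := by
      ext i
      fin_cases i <;> rfl
    simp [signedSet, splitSum, negSum, crossInv, qPoch_zero, qFactInv_zero,
      Finset.Nat.antidiagonalTuple_zero_right, h]
  | succ n ih =>
    rw [range_add_one, sum_powerset_insert notMem_range_self, ← sum_add_distrib]
    -- The letter of largest absolute value is either the maximum `n + 1` or the minimum `-(n + 1)`,
    -- and goes to `V` or to its complement: four cases.
    have h1 : ∀ N ∈ (range n).powerset, splitSum (signedSet (n + 1) N) f +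
        splitSum (signedSet (n + 1) (insert n N)) f =
        splitSum (signedSet n N) fun c =>
          q ^ (c 2 + c 3) * f (c + Pi.single 0 1) + f (c + Pi.single 3 1) +
          (q ^ (n + 1) * f (c + Pi.single 1 1) +
            q ^ (n + 1 + c 0 + c 1) * f (c + Pi.single 2 1)) := by
      intro N hN
      rw [mem_powerset] at hN
      have hn : n ∉ N := fun h => by simpa using hN h
      have h0 : (0 : ℤ) ∉ signedSet n N := fun h => (abs_le_of_mem_signedSet h).1 rfl
      rw [signedSet_succ_of_notMem hn, signedSet_succ_insert,
        splitSum_insert_pos h0 (by omega) fun t ht => by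
          have := abs_le_of_mem_signedSet ht; omega,
        splitSum_insert_neg h0 (by omega) fun t ht => by
          have := abs_le_of_mem_signedSet ht; omega]
      have habs : (-((n : ℤ) + 1)).natAbs = n + 1 := by omega
      rw [habs, splitSum, splitSum, splitSum, ← sum_add_distrib]
      exact sum_congr rfl fun V _ => by ring
    rw [sum_congr rfl h1, ih, qPoch_succ, ← pow_succ', mul_assoc]
    congr 1
    let W : (Fin 4 → ℕ) → R := fun m =>
      qFactInv (m 0) * qFactInv (m 1) * qFactInv (m 2) * qFactInv (m 3) * f m
    have e0 := sum_antidiagonalTuple_succ (k := 4) (n := n) 0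
      fun m => W m * q ^ (m 3 + (m 1 + m 2 + 1).choose 2 + m 0 * m 2)
    have e1 := sum_antidiagonalTuple_succ (k := 4) (n := n) 1
      fun m => W m * q ^ (n + 1 + (m 1 + m 2).choose 2 + m 0 * m 2)
    have e2 := sum_antidiagonalTuple_succ (k := 4) (n := n) 2
      fun m => W m * q ^ (m 1 + (n + 1) + (m 1 + m 2).choose 2 + m 0 * m 2)
    have e3 := sum_antidiagonalTuple_succ (k := 4) (n := n) 3
      fun m => W m * q ^ ((m 1 + m 2 + 1).choose 2 + m 0 * m 2)
    -- `1 - q^(n+1)` telescopes along the entries in the order 3, 0, 1, 2, which matches the four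
    -- cases above. In the terms for entries 1 and 2, writing the binomial as `(m 1 + m 2).choose 2`
    -- avoids a subtraction in the exponent.
    have hsplit : (1 - q ^ (n + 1)) * ∑ m ∈ Finset.Nat.antidiagonalTuple 4 (n + 1),
        qFactInv (m 0) * qFactInv (m 1) * qFactInv (m 2) * qFactInv (m 3) *
          q ^ ((m 1 + m 2 + 1).choose 2 + m 0 * m 2) * f m =
        ∑ m ∈ Finset.Nat.antidiagonalTuple 4 (n + 1),
          ((1 - q ^ m 0) * (W m * q ^ (m 3 + (m 1 + m 2 + 1).choose 2 + m 0 * m 2)) +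
          (1 - q ^ m 1) * (W m * q ^ (n + 1 + (m 1 + m 2).choose 2 + m 0 * m 2)) +
          (1 - q ^ m 2) * (W m * q ^ (m 1 + (n + 1) + (m 1 + m 2).choose 2 + m 0 * m 2)) +
          (1 - q ^ m 3) * (W m * q ^ ((m 1 + m 2 + 1).choose 2 + m 0 * m 2))) := by
      rw [mul_sum]
      refine sum_congr rfl fun m hm => ?_
      rw [Finset.Nat.mem_antidiagonalTuple, Fin.sum_univ_four] at hm
      rw [choose_two_succ, ← hm]
      simp only [W]
      ring
    rw [hsplit, sum_add_distrib, sum_add_distrib, sum_add_distrib, e0, e1, e2, e3,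
      ← sum_add_distrib, ← sum_add_distrib, ← sum_add_distrib]
    refine sum_congr rfl fun m hm => ?_
    have r0 := one_sub_q_pow_mul_qFactInv (m 0)
    have r1 := one_sub_q_pow_mul_qFactInv (m 1)
    have r2 := one_sub_q_pow_mul_qFactInv (m 2)
    have r3 := one_sub_q_pow_mul_qFactInv (m 3)
    have h12 : m 1 + 1 + m 2 = m 1 + m 2 + 1 := by omega
    simp only [W, Pi.add_apply, Pi.single_apply, Fin.reduceEq, if_true, if_false, add_zero,
      h12, ← add_assoc]
    linear_combination
      -(qFactInv (m 1) * qFactInv (m 2) * qFactInv (m 3) * f (m + Pi.single 0 1) *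
        q ^ (m 3 + (m 1 + m 2 + 1).choose 2 + (m 0 + 1) * m 2)) * r0 -
      (qFactInv (m 0) * qFactInv (m 2) * qFactInv (m 3) * f (m + Pi.single 1 1) *
        q ^ (n + 1 + (m 1 + m 2 + 1).choose 2 + m 0 * m 2)) * r1 -
      (qFactInv (m 0) * qFactInv (m 1) * qFactInv (m 3) * f (m + Pi.single 2 1) *
        q ^ (m 1 + n + 1 + (m 1 + m 2 + 1).choose 2 + m 0 * (m 2 + 1))) * r2 -
      (qFactInv (m 0) * qFactInv (m 1) * qFactInv (m 2) * f (m + Pi.single 3 1) *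
        q ^ ((m 1 + m 2 + 1).choose 2 + m 0 * m 2)) * r3

/-! ### From signed permutations to q-multinomial coefficients -/

/-- The signed permutations are the arrangements of the signed sets. -/
theorem sum_signedPerms_eq {M : Type*} [AddCommMonoid M] (n : ℕ) (f : List ℤ → M) :
    ∑ w ∈ signedPerms n, f (List.ofFn w) =
      ∑ N ∈ (range n).powerset, ∑ l ∈ arrangements (signedSet n N), f l := by
  classical
  rw [sum_sigma']
  symm
  refine Finset.sum_bij (fun s _ i => s.2.getD i 0) ?_ ?_ ?_ ?_
  · rintro ⟨N, l⟩ h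
    rw [mem_sigma, mem_arrangements] at h
    obtain ⟨-, hl, hlT⟩ := h
    dsimp only at *
    have hlen : l.length = n := by
      rw [← List.toFinset_card_of_nodup hl, hlT, card_signedSet]
    have hget : ∀ i : Fin n, l.getD i 0 = l[(i : ℕ)]'(by omega) := fun i =>
      List.getD_eq_getElem _ _ _
    have hmem : ∀ i : Fin n, l.getD i 0 ∈ signedSet n N := by
      intro i
      rw [hget, ← hlT, List.mem_toFinset]
      exact List.getElem_mem _
    rw [signedPerms, mem_filter, Fintype.mem_piFinset]
    refine ⟨fun i => ?_, fun i j hij => ?_⟩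
    · rw [mem_erase, mem_Icc]
      exact abs_le_of_mem_signedSet (hmem i)
    · have h := abs_injOn_signedSet (hmem i) (hmem j) hij
      rw [hget, hget, hl.getElem_inj_iff] at h
      exact Fin.ext h
  · rintro ⟨N, l⟩ h ⟨N', l'⟩ h' heq
    rw [mem_sigma, mem_powerset, mem_arrangements] at h h'
    obtain ⟨hN, hl, hlT⟩ := h
    obtain ⟨hN', hl', hlT'⟩ := h'
    dsimp only at *
    have hlen : l.length = n := by
      rw [← List.toFinset_card_of_nodup hl, hlT, card_signedSet]
    have hlen' : l'.length = n := by
      rw [← List.toFinset_card_of_nodup hl', hlT', card_signedSet]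
    obtain rfl : l = l' := by
      refine List.ext_getElem (by omega) fun i hi hi' => ?_
      rw [← List.getD_eq_getElem l 0 hi, ← List.getD_eq_getElem l' 0 hi']
      exact congrFun heq ⟨i, by omega⟩
    obtain rfl : N = N' := by
      ext a
      have h1 := neg_mem_signedSet (n := n) (N := N) a
      have h2 := neg_mem_signedSet (n := n) (N := N') a
      rw [← hlT, hlT', h2] at h1
      constructor
      · exact fun ha => (h1.2 ⟨mem_range.1 (hN ha), ha⟩).2
      · exact fun ha => (h1.1 ⟨mem_range.1 (hN' ha), ha⟩).2
    rfl
  · intro w hw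
    rw [signedPerms, mem_filter, Fintype.mem_piFinset] at hw
    obtain ⟨hw, hinj⟩ := hw
    have hwinj : Function.Injective w := fun i j h => hinj (congrArg abs h)
    -- The sign choice is read off from the word; the index `a` stands for the absolute value `a +
    -- 1`.
    refine ⟨⟨(range n).filter fun a => -((a : ℤ) + 1) ∈ List.ofFn w, List.ofFn w⟩, ?_, ?_⟩
    · rw [mem_sigma, mem_powerset, mem_arrangements]
      refine ⟨filter_subset _ _, List.nodup_ofFn.2 hwinj, ?_⟩
      dsimp only
      refine eq_of_subset_of_card_le ?_ ?_
      · intro t ht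
        rw [List.mem_toFinset, List.mem_ofFn] at ht
        obtain ⟨i, rfl⟩ := ht
        have hi := hw i
        rw [mem_erase, mem_Icc] at hi
        rcases lt_or_gt_of_ne hi.1 with h | h
        · have ht : w i = -((((w i).natAbs - 1 : ℕ) : ℤ) + 1) := by omega
          rw [ht, neg_mem_signedSet, mem_filter, mem_range, ← ht]
          refine ⟨by omega, by omega, ?_⟩
          rw [List.mem_ofFn]
          exact ⟨i, rfl⟩
        · have ht : w i = ((((w i).natAbs - 1 : ℕ) : ℤ) + 1) := by omega
          rw [mem_signedSet]
          refine ⟨(w i).natAbs - 1, by omega, ?_⟩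
          rw [if_neg, ← ht]
          rw [mem_filter, ← ht, List.mem_ofFn]
          rintro ⟨-, j, hj⟩
          have hji : j = i := hinj (by dsimp only; rw [hj, abs_neg])
          rw [hji] at hj
          omega
      · rw [card_signedSet, List.toFinset_card_of_nodup (List.nodup_ofFn.2 hwinj), List.length_ofFn]
    · funext i
      dsimp only
      rw [List.getD_eq_getElem _ _ (by simp)]
      simp
  · rintro ⟨N, l⟩ h
    rw [mem_sigma, mem_arrangements] at h
    obtain ⟨-, hl, hlT⟩ := h
    dsimp only at *
    have hlen : l.length = n := by
      rw [← List.toFinset_card_of_nodup hl, hlT, card_signedSet]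
    congr 1
    refine List.ext_getElem (by simp [hlen]) fun i hi hi' => ?_
    rw [List.getElem_ofFn, List.getD_eq_getElem]

theorem len_eq {n : ℕ} {w : Fin n → ℤ} (hw : (List.ofFn w).Nodup) :
    len w = linv (List.ofFn w) + negSum (List.ofFn w).toFinset := by
  rw [len, inv_eq_linv, negSum, List.sum_toFinset _ hw, List.map_ofFn, List.sum_ofFn]
  rfl

theorem neg_eq {n : ℕ} {w : Fin n → ℤ} (hw : (List.ofFn w).Nodup) :
    neg w = #{t ∈ (List.ofFn w).toFinset | t < 0} := by
  rw [← countP_eq_card_filter hw, countP_ofFn, neg]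

theorem nodup_ofFn_of_mem_signedPerms {n : ℕ} {w : Fin n → ℤ} (hw : w ∈ signedPerms n) :
    (List.ofFn w).Nodup :=
  List.nodup_ofFn.2 fun _ _ h => (mem_filter.1 hw).2 (congrArg abs h)

/-- Once the signs and `V` are fixed, every statistic except the inversions of `d` depends only on
`V` and its complement, so the sum over `d` factors out as a derangement polynomial. -/
theorem sum_signedPerms_eq_sum_splitSum (n : ℕ) :
    ∑ w ∈ signedPerms n, q ^ len w * Y₀ ^ pixPos w * Y₁ ^ pixNeg w * Z ^ neg w =
      ∑ N ∈ (range n).powerset, splitSum (signedSet n N) fun m =>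
        Y₀ ^ m 0 * Y₁ ^ m 1 * Z ^ (m 1 + m 2) * derangementPoly (m 2 + m 3) q := by
  let F : List ℤ → R := fun l => q ^ (linv l + negSum l.toFinset) *
    Y₀ ^ (pixPrefix l).countP (0 < ·) * Y₁ ^ (pixPrefix l).countP (· < 0) *
      Z ^ #{t ∈ l.toFinset | t < 0}
  have h1 : ∀ w ∈ signedPerms n, q ^ len w * Y₀ ^ pixPos w * Y₁ ^ pixNeg w * Z ^ neg w =
      F (List.ofFn w) := by
    intro w hw
    have hnd := nodup_ofFn_of_mem_signedPerms hw
    rw [len_eq hnd, neg_eq hnd]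
    rfl
  rw [sum_congr rfl h1, sum_signedPerms_eq]
  refine sum_congr rfl fun N _ => ?_
  rw [sum_arrangements_eq, splitSum]
  have h0 : (0 : ℤ) ∉ signedSet n N := fun h => (abs_le_of_mem_signedSet h).1 rfl
  generalize signedSet n N = T at h0
  refine sum_congr rfl fun V hV => ?_
  rw [mem_powerset] at hV
  have hF : ∀ d ∈ desarrangements (T \ V), F (V.sort ++ d) =
      q ^ (negSum T + crossInv V (T \ V)) * (Y₀ ^ signCounts V (T \ V) 0 *
        Y₁ ^ signCounts V (T \ V) 1 *
        Z ^ (signCounts V (T \ V) 1 + signCounts V (T \ V) 2)) * q ^ linv d := by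
    intro d hd
    have hd' := (mem_desarrangements.1 hd).1
    have hT := (mem_arrangements.1 (sort_append_mem_arrangements hV hd')).2
    have hZ : #{t ∈ T | t < 0} = signCounts V (T \ V) 1 + signCounts V (T \ V) 2 := by
      have : ({t ∈ T | t < 0} : Finset ℤ) = {t ∈ V | t < 0} ∪ {t ∈ T \ V | t < 0} := by
        rw [← filter_union, union_sdiff_of_subset hV]
      rw [this, card_union_of_disjoint (disjoint_filter_filter disjoint_sdiff)]
      rfl
    simp only [F]
    rw [hT, pixPrefix_sort_append hV hd, linv_sort_append hd', hZ,
      countP_eq_card_filter (sort_nodup V (· ≤ ·)), countP_eq_card_filter (sort_nodup V (· ≤ ·)),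
      sort_toFinset]
    have e0 : #{t ∈ V | 0 < t} = signCounts V (T \ V) 0 := rfl
    have e1 : #{t ∈ V | t < 0} = signCounts V (T \ V) 1 := rfl
    rw [e0, e1]
    ring
  rw [sum_congr rfl hF, ← mul_sum, sum_desarrangements_pow_linv,
    card_eq_add_of_zero_notMem fun h => h0 (mem_sdiff.1 h).1]
  have e2 : #{t ∈ T \ V | t < 0} = signCounts V (T \ V) 2 := rfl
  have e3 : #{t ∈ T \ V | 0 < t} = signCounts V (T \ V) 3 := rfl
  rw [e2, e3]
  ring

/-- The sum over the signed permutations as a sum of `q`-multinomial coefficients. -/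
theorem sum_signedPerms_eq_sum_qMultinomial (n : ℕ) :
    ∑ w ∈ signedPerms n, q ^ len w * Y₀ ^ pixPos w * Y₁ ^ pixNeg w * Z ^ neg w =
      ∑ m ∈ Finset.Nat.antidiagonalTuple 4 n, qMultinomial m * q ^ (m 1 + m 2 + 1).choose 2 *
        Y₀ ^ m 0 * (Y₁ * Z) ^ m 1 * (Z * q ^ m 0) ^ m 2 * derangementPoly (m 2 + m 3) q := by
  rw [sum_signedPerms_eq_sum_splitSum, sum_splitSum, mul_sum]
  refine sum_congr rfl fun m hm => ?_
  rw [qMultinomial_four, Finset.Nat.mem_antidiagonalTuple.1 hm]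
  ring

/-! ### The q-multinomial formula and the defining identity -/

theorem sum_antidiagonalTuple_four {M : Type*} [AddCommMonoid M] (n : ℕ)
    (f : (Fin 4 → ℕ) → M) :
    ∑ m ∈ Finset.Nat.antidiagonalTuple 4 n, f m =
      ∑ p ∈ antidiagonal n, ∑ a ∈ antidiagonal p.1, ∑ b ∈ antidiagonal p.2,
        f ![a.1, a.2, b.2, b.1] := by
  simp_rw [← sum_product', sum_sigma']
  symm
  -- The second pair is `(l, k)`, so that `k` is the index carrying the exponent `k.choose 2` in the
  -- q-binomial theorem.
  refine Finset.sum_bij' (fun s _ => ![s.2.1.1, s.2.1.2, s.2.2.2, s.2.2.1])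
    (fun m _ => ⟨(m 0 + m 1, m 2 + m 3), ((m 0, m 1), (m 3, m 2))⟩) ?_ ?_ ?_ ?_ ?_
  · rintro ⟨⟨p, s⟩, ⟨i, j⟩, ⟨l, k⟩⟩ h
    simp only [mem_sigma, HasAntidiagonal.mem_antidiagonal, mem_product] at h
    rw [Finset.Nat.mem_antidiagonalTuple, Fin.sum_univ_four]
    simp
    omega
  · intro m hm
    rw [Finset.Nat.mem_antidiagonalTuple, Fin.sum_univ_four] at hm
    simp only [mem_sigma, HasAntidiagonal.mem_antidiagonal, mem_product]
    refine ⟨by omega, trivial, add_comm _ _⟩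
  · rintro ⟨⟨p, s⟩, ⟨i, j⟩, ⟨l, k⟩⟩ h
    simp only [mem_sigma, HasAntidiagonal.mem_antidiagonal, mem_product] at h
    obtain ⟨-, rfl, rfl⟩ := h
    simp [add_comm]
  · intro m _
    ext i
    fin_cases i <;> rfl
  · intro _ _
    rfl

/-- Together with the factor `q^(i k)`, the terms `k + j k` make up `k (i + j + 1)`: the sum over
`k` becomes a q-binomial sum in `Z q^(i+j+1)`, depending on `(i, j)` only through `i + j`. -/
theorem choose_two_add (j k : ℕ) :
    (j + k + 1).choose 2 = (j + 1).choose 2 + k.choose 2 + k + j * k := by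
  induction k with
  | zero => simp
  | succ k ih =>
    rw [← add_assoc, choose_two_succ (j + k + 1), ih, choose_two_succ k]
    ring

theorem constantCoeff_neg_Z_mul_q : PowerSeries.constantCoeff (-Z * q) = 0 := by
  rw [map_mul, constantCoeff_q, mul_zero]

theorem Y₀_mul_inv : Y₀ * Y₀⁻¹ = 1 := by
  refine PowerSeries.mul_inv_cancel _ ?_
  rw [Y₀, PowerSeries.constantCoeff_C]
  exact (map_ne_zero_iff _ (IsFractionRing.injective _ K)).2 (MvPolynomial.X_ne_zero _)

theorem qPoch_mul_pow_mul_qFactInv (p : ℕ) :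
    qPoch (-q * Y₀⁻¹ * Y₁ * Z) q p * Y₀ ^ p * qFactInv p =
      ∑ a ∈ antidiagonal p, q ^ (a.2 + 1).choose 2 * Y₀ ^ a.1 * (Y₁ * Z) ^ a.2 *
        (qFactInv a.1 * qFactInv a.2) := by
  have h : qPoch (-q * Y₀⁻¹ * Y₁ * Z) q p * Y₀ ^ p =
      ∏ s ∈ range p, (Y₀ + q * (Y₁ * Z) * q ^ s) := by
    conv_lhs => rw [qPoch, ← card_range p, ← prod_const, card_range, ← prod_mul_distrib]
    refine prod_congr rfl fun s _ => ?_
    linear_combination q * Y₁ * Z * q ^ s * Y₀_mul_inv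
  rw [h, ← sum_antidiagonal_qBinomial]
  refine sum_congr rfl fun a _ => ?_
  rw [choose_two_succ]
  ring

theorem sum_qMultinomial_eq (n : ℕ) :
    ∑ m ∈ Finset.Nat.antidiagonalTuple 4 n, qMultinomial m * q ^ (m 1 + m 2 + 1).choose 2 *
        Y₀ ^ m 0 * (Y₁ * Z) ^ m 1 * (Z * q ^ m 0) ^ m 2 * derangementPoly (m 2 + m 3) q =
      qPoch q q n * ∑ p ∈ antidiagonal n, derangementPoly p.2 q * qFactInv p.2 *
        qPoch (-Z * q * q ^ p.1) q p.2 *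
          (qPoch (-q * Y₀⁻¹ * Y₁ * Z) q p.1 * Y₀ ^ p.1 * qFactInv p.1) := by
  rw [sum_antidiagonalTuple_four, mul_sum]
  refine sum_congr rfl fun p hp => ?_
  rw [qPoch_mul_pow_mul_qFactInv, mul_sum, mul_sum]
  refine sum_congr rfl fun a ha => ?_
  rw [HasAntidiagonal.mem_antidiagonal] at hp ha
  calc _ = qPoch q q n * (derangementPoly p.2 q * (∑ b ∈ antidiagonal p.2, q ^ (b.2.choose 2) *
        1 ^ b.1 * (Z * q * q ^ p.1) ^ b.2 * (qFactInv b.1 * qFactInv b.2)) *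
        (q ^ (a.2 + 1).choose 2 * Y₀ ^ a.1 * (Y₁ * Z) ^ a.2 *
          (qFactInv a.1 * qFactInv a.2))) := by
        rw [mul_sum, sum_mul, mul_sum]
        refine sum_congr rfl fun b hb => ?_
        rw [HasAntidiagonal.mem_antidiagonal] at hb
        rw [qMultinomial_four, Fin.sum_univ_four]
        have hn : a.1 + a.2 + b.2 + b.1 = n := by omega
        have hs : b.2 + b.1 = p.2 := by omega
        simp only [Matrix.cons_val, hn, hs, choose_two_add, ← ha]
        ring
    _ = _ := by
        rw [sum_antidiagonal_qBinomial, show (∏ s ∈ range p.2, (1 + Z * q * q ^ p.1 * q ^ s)) =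
          qPoch (-Z * q * q ^ p.1) q p.2 from prod_congr rfl fun s _ => by ring]
        ring

theorem inverse_mul_uPochInf :
    Ring.inverse (1 - u * PowerSeries.C ((1 - q)⁻¹ : R)) * uPochInf =
      PowerSeries.mk fun n => derangementPoly n q * qFactInv n := by
  have h : (1 - u * PowerSeries.C ((1 - q)⁻¹ : R)) *
      PowerSeries.mk (fun n => ((1 - q)⁻¹ : R) ^ n) = 1 := by
    ext1 n
    have hu : u * PowerSeries.C ((1 - q)⁻¹ : R) =
        PowerSeries.C ((1 - q)⁻¹ : R) * PowerSeries.X := mul_comm _ _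
    rw [sub_mul, one_mul, hu, mul_assoc, map_sub, PowerSeries.coeff_C_mul]
    cases n with
    | zero => simp
    | succ n =>
      rw [PowerSeries.coeff_succ_X_mul, PowerSeries.coeff_mk, PowerSeries.coeff_mk, pow_succ',
        sub_self, PowerSeries.coeff_one, if_neg n.succ_ne_zero]
  have hinv : Ring.inverse (1 - u * PowerSeries.C ((1 - q)⁻¹ : R)) =
      PowerSeries.mk fun n => ((1 - q)⁻¹ : R) ^ n := by
    have h' := Ring.inverse_mul_cancel _ (IsUnit.of_mul_eq_one _ h)
    exact left_inv_eq_right_inv h' h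
  rw [hinv, mul_comm, mk_derangementPoly_mul_qFactInv]

theorem coeff_rhs_definingIdentity (n : ℕ) :
    PowerSeries.coeff n (Ring.inverse (1 - u * PowerSeries.C ((1 - q)⁻¹ : R)) * uPochInf *
      PowerSeries.mk (fun n => qPoch (-q * Y₀⁻¹ * Y₁ * Z) q n * Y₀ ^ n *
        (qPoch (-Z * q) q n * qPoch q q n)⁻¹)) =
      (∑ m ∈ Finset.Nat.antidiagonalTuple 4 n, qMultinomial m * q ^ (m 1 + m 2 + 1).choose 2 *
        Y₀ ^ m 0 * (Y₁ * Z) ^ m 1 * (Z * q ^ m 0) ^ m 2 * derangementPoly (m 2 + m 3) q) *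
        (qPoch (-Z * q) q n * qPoch q q n)⁻¹ := by
  rw [inverse_mul_uPochInf, sum_qMultinomial_eq, mul_comm (PowerSeries.mk _),
    PowerSeries.coeff_mul, PowerSeries.mul_inv_rev]
  have hq := qPoch_mul_inv constantCoeff_q n
  have hcancel : ∀ S : R, qPoch q q n * S * ((qPoch q q n)⁻¹ * (qPoch (-Z * q) q n)⁻¹) =
      S * (qPoch (-Z * q) q n)⁻¹ := fun S => by
    linear_combination S * (qPoch (-Z * q) q n)⁻¹ * hq
  rw [hcancel, sum_mul]
  refine sum_congr rfl fun p hp => ?_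
  rw [HasAntidiagonal.mem_antidiagonal] at hp
  rw [PowerSeries.coeff_mk, PowerSeries.coeff_mk, PowerSeries.mul_inv_rev]
  have h1 := qPoch_mul_inv constantCoeff_neg_Z_mul_q p.1
  have h2 := qPoch_mul_inv constantCoeff_neg_Z_mul_q n
  -- The factor `(-Zq^(p+1); q)_(n-p)` from the sum over `(k, l)` is exactly what turns `1/(-Zq;
  -- q)_n` into `1/(-Zq; q)_p`.
  have h3 : (qPoch (-Z * q) q p.1)⁻¹ =
      qPoch (-Z * q * q ^ p.1) q p.2 * (qPoch (-Z * q) q n)⁻¹ := by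
    rw [← hp, qPoch_add] at h2 ⊢
    linear_combination -(qPoch (-Z * q) q p.1)⁻¹ * h2 +
      qPoch (-Z * q * q ^ p.1) q p.2 *
        (qPoch (-Z * q) q p.1 * qPoch (-Z * q * q ^ p.1) q p.2)⁻¹ * h1
  rw [h3, ← qFactInv]
  ring

/-- The coefficient of `u^n` involves `B n` alone, multiplied by a nonzero factor that also appears
on the other side. -/
theorem definingIdentity_iff (B : ℕ → R) :
    DefiningIdentity B ↔ ∀ n, B n = ∑ m ∈ Finset.Nat.antidiagonalTuple 4 n,
      qMultinomial m * q ^ (m 1 + m 2 + 1).choose 2 * Y₀ ^ m 0 * (Y₁ * Z) ^ m 1 *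
        (Z * q ^ m 0) ^ m 2 * derangementPoly (m 2 + m 3) q := by
  rw [DefiningIdentity, PowerSeries.ext_iff]
  refine forall_congr' fun n => ?_
  rw [coeff_rhs_definingIdentity, PowerSeries.coeff_mk]
  refine mul_left_inj' fun h => ?_
  have h1 := qPoch_mul_inv constantCoeff_neg_Z_mul_q n
  have h2 := qPoch_mul_inv constantCoeff_q n
  rw [PowerSeries.mul_inv_rev] at h
  refine one_ne_zero (α := R) ?_
  linear_combination -h1 - (qPoch (-Z * q) q n * (qPoch (-Z * q) q n)⁻¹) * h2 +
    qPoch (-Z * q) q n * qPoch q q n * h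

end

end SignedPixed

theorem theorem1p2 :
    (∀ B : ℕ → SignedPixed.R,
      SignedPixed.DefiningIdentity B ↔
        ∀ n : ℕ, B n = ∑ w ∈ SignedPixed.signedPerms n,
          SignedPixed.q ^ SignedPixed.len w * SignedPixed.Y₀ ^ SignedPixed.pixPos w *
            SignedPixed.Y₁ ^ SignedPixed.pixNeg w * SignedPixed.Z ^ SignedPixed.neg w) ∧
    (∀ B : ℕ → SignedPixed.R,
      SignedPixed.DefiningIdentity B ↔
        ∀ n : ℕ, B n = ∑ m ∈ Finset.Nat.antidiagonalTuple 4 n,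
          SignedPixed.qMultinomial m *
            SignedPixed.q ^ (m 1 + m 2 + 1).choose 2 *
            SignedPixed.Y₀ ^ m 0 * (SignedPixed.Y₁ * SignedPixed.Z) ^ m 1 *
            (SignedPixed.Z * SignedPixed.q ^ m 0) ^ m 2 *
            SignedPixed.derangementPoly (m 2 + m 3) SignedPixed.q) := by
  refine ⟨fun B => ?_, SignedPixed.definingIdentity_iff⟩
  simp only [SignedPixed.sum_signedPerms_eq_sum_qMultinomial]
  exact SignedPixed.definingIdentity_iff B
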